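/- Let $\tau(n)$ be the number of divisors of $n$, let $\tau_{1,2}(n)=\#\{(a,b)\in\mathbb N^2: ab^2=n\}$, and let $\tau^{(e)}$ be the exponential divisor function, that is, the multiplicative function with $\tau^{(e)}(p^{\nu})=\tau(\nu)$ for all primes $p$ and all $\nu\ge 1$. Let $\theta_2$ be the infimum of all real $\theta$ such that $$\sum_{n\le x}\tau_{1,2}(n)=\zeta(2)\,x+\zeta(1/2)\,x^{1/2}+O(x^{\theta+\varepsilon})\quad\text{for every }\varepsilon>0 .$$ This infimum is finite and attained. Put $\theta_2^*=\max(\theta_2,1/5)$. Let $r\ge 2$ be an integer. Then, as $x\to\infty$, for every $\varepsilon>0$, $$\sum_{n_1,\ldots,n_r\le x}\tau^{(e)}(n_1\cdots n_r)=K_r x^r+L_r x^{r-1/2}+O\bigl(x^{r-1+\theta_2^*+\varepsilon}\bigr),$$ $$\sum_{n_1,\ldots,n_r\le x}\tau^{(e)}([n_1,\ldots,n_r])=K'_r x^r+L'_r x^{r-1/2}+O\bigl(x^{r-1+\theta_2^*+\varepsilon}\bigr),$$ where the $n_i$ run over positive integers, $[n_1,\ldots,n_r]$ is the least common multiple, the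 implied constants depend only on $r$ and $\varepsilon$, and, with products over all primes, $$K_r=\prod_p\Bigl(1-\frac1p\Bigr)^r\Bigl(1+\sum_{\substack{\nu_1,\ldots,\nu_r\ge 0\\ \nu_1+\cdots+\nu_r\ge 1}}\frac{\tau(\nu_1+\cdots+\nu_r)}{p^{\nu_1+\cdots+\nu_r}}\Bigr),$$ $$K'_r=\prod_p\Bigl(1-\frac1p\Bigr)^r\Bigl(1+\sum_{\substack{\nu_1,\ldots,\nu_r\ge 0\\ \nu_1+\cdots+\nu_r\ge 1}}\frac{\tau(\max(\nu_1,\ldots,\nu_r))}{p^{\nu_1+\cdots+\nu_r}}\Bigr),$$ $$L_r=r\,\zeta(1/2)\prod_p\Bigl(1-\frac1p\Bigr)^r\Bigl(1-\frac1{p^{1/2}}\Bigr)\Bigl(1+\sum_{\substack{\nu_1,\ldots,\nu_r\ge 0\\ \nu_1+\cdots+\nu_r\ge 1}}\frac{\tau(\nu_1+\cdots+\nu_r)}{p^{\nu_1/2+\nu_2+\cdots+\nu_r}}\Bigr),$$ $$L'_r=r\,\zeta(1/2)\prod_p\Bigl(1-\frac1p\Bigr)^r\Bigl(1-\frac1{p^{1/2}}\Bigr)\Bigl(1+\sum_{\substack{\nu_1,\ldots,\nu_r\ge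 0\\ \nu_1+\cdots+\nu_r\ge 1}}\frac{\tau(\max(\nu_1,\ldots,\nu_r))}{p^{\nu_1/2+\nu_2+\cdots+\nu_r}}\Bigr).$$ All these series and products converge. -/

import Mathlib

open Filter Topology Asymptotics

noncomputable section

/-- The exponential divisor function `τ^(e)`: multiplicative, with `τ^(e)(p^ν) = τ(ν)` for every
prime `p` and every `ν ≥ 1` (only positive arguments matter). -/
def tauExp (n : ℕ) : ℕ :=
  n.factorization.prod fun _ ν => ν.divisors.card

/-- The divisor function `τ_{1,k}(n) = ∑_{a b^k = n} 1` (for `n ≥ 1`). -/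
def tauOne (k n : ℕ) : ℕ :=
  ((n.divisors ×ˢ n.divisors).filter fun ab => ab.1 * ab.2 ^ k = n).card

/-- The Riemann zeta function at a real point, as a real number. -/
def zetaReal (s : ℝ) : ℝ := (riemannZeta (s : ℂ)).re

/-- `ζ` is real at real points, so taking the real part loses nothing. -/
theorem ofReal_zetaReal (s : ℝ) : ((zetaReal s : ℝ) : ℂ) = riemannZeta (s : ℂ) := by
  have h := riemannZeta_conj (s : ℂ)
  rw [Complex.conj_ofReal] at h
  exact (Complex.conj_eq_iff_re.mp h.symm)

/-- `θ` is an error exponent for `τ_{1,2}`: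
`∑_{n ≤ x} τ_{1,2}(n) = ζ(2) x + ζ(1/2) x^{1/2} + O(x^{θ+ε})` for every `ε > 0`. -/
def IsErrorExponent (θ : ℝ) : Prop :=
  ∀ ε : ℝ, 0 < ε →
    (fun x : ℝ => (∑ n ∈ Finset.Icc 1 ⌊x⌋₊, (tauOne 2 n : ℝ))
        - (zetaReal 2 * x + zetaReal (1 / 2) * x ^ (1 / 2 : ℝ)))
      =O[atTop] fun x : ℝ => x ^ (θ + ε)

/-- `θ₂`, the exponent in the asymptotic formula for `∑_{n ≤ x} τ_{1,2}(n)`. -/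
def thetaTwo : ℝ := sInf {θ : ℝ | IsErrorExponent θ}

/-- The term of index `ν = (ν_1, …, ν_r)` in the local series at `p` with coefficients `c`, at the
point `(s_1, …, s_r)`: `c(ν) / p^{ν_1 s_1 + ⋯ + ν_r s_r}` if `ν_1 + ⋯ + ν_r ≥ 1`, and `0` if
`ν = 0`. -/
def localTerm {r : ℕ} (c : (Fin r → ℕ) → ℕ) (s : Fin r → ℝ) (p : ℕ) (ν : Fin r → ℕ) : ℝ :=
  if 1 ≤ ∑ i, ν i then (c ν : ℝ) / (p : ℝ) ^ (∑ i, (ν i : ℝ) * s i) else 0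

/-- `1 + ∑_{ν ≠ 0} c(ν) / p^{ν_1 s_1 + ⋯ + ν_r s_r}`. -/
def localSeries {r : ℕ} (c : (Fin r → ℕ) → ℕ) (s : Fin r → ℝ) (p : ℕ) : ℝ :=
  1 + ∑' ν : Fin r → ℕ, localTerm c s p ν

/-- The point `(1, …, 1)`. -/
def onePoint (r : ℕ) : Fin r → ℝ := fun _ => 1

/-- The point `(1/2, 1, …, 1)`. -/
def halfPoint (r : ℕ) : Fin r → ℝ := fun i => if (i : ℕ) = 0 then 1 / 2 else 1

/-- The Euler factor at `p` of the leading constant: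
`(1 - 1/p)^r (1 + ∑_{ν ≠ 0} c(ν) / p^{ν_1 + ⋯ + ν_r})`. -/
def leadFactor {r : ℕ} (c : (Fin r → ℕ) → ℕ) (p : ℕ) : ℝ :=
  (1 - 1 / (p : ℝ)) ^ r * localSeries c (onePoint r) p

/-- The leading constant: the product of the factors `leadFactor c p` over all primes `p`. -/
def leadConst {r : ℕ} (c : (Fin r → ℕ) → ℕ) : ℝ :=
  ∏' p : Nat.Primes, leadFactor c (p : ℕ)

/-- The Euler factor at `p` of the second constant:
`(1 - 1/p)^r (1 - 1/p^{1/2}) (1 + ∑_{ν ≠ 0} c(ν) / p^{ν_1/2 + ν_2 + ⋯ + ν_r})`. -/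
def secondFactor {r : ℕ} (c : (Fin r → ℕ) → ℕ) (p : ℕ) : ℝ :=
  (1 - 1 / (p : ℝ)) ^ r * (1 - 1 / (p : ℝ) ^ (1 / 2 : ℝ)) * localSeries c (halfPoint r) p

/-- The second constant: `r ζ(1/2)` times the product of the factors `secondFactor c p` over all
primes `p`. -/
def secondConst {r : ℕ} (c : (Fin r → ℕ) → ℕ) : ℝ :=
  (r : ℝ) * zetaReal (1 / 2) * ∏' p : Nat.Primes, secondFactor c (p : ℕ)

/-- The coefficient `τ(ν_1 + ⋯ + ν_r)`, for `ν ≠ 0`. -/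
def sumCoeff (r : ℕ) (ν : Fin r → ℕ) : ℕ := (∑ i, ν i).divisors.card

/-- The coefficient `τ(max(ν_1, …, ν_r))`, for `ν ≠ 0`. -/
def maxCoeff (r : ℕ) (ν : Fin r → ℕ) : ℕ := (Finset.univ.sup ν).divisors.card

/-- The `r`-tuples of positive integers `n_1, …, n_r ≤ x`. -/
def tuplesUpTo (r : ℕ) (x : ℝ) : Finset (Fin r → ℕ) :=
  Fintype.piFinset fun _ => Finset.Icc 1 ⌊x⌋₊

/-- All local series and both Euler products that define the two constants attached to `c`
converge. -/
def ConstantsConverge {r : ℕ} (c : (Fin r → ℕ) → ℕ) : Prop :=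
  (∀ p : Nat.Primes, Summable (localTerm c (onePoint r) (p : ℕ))) ∧
  (∀ p : Nat.Primes, Summable (localTerm c (halfPoint r) (p : ℕ))) ∧
  Multipliable (fun p : Nat.Primes => leadFactor c (p : ℕ)) ∧
  Multipliable (fun p : Nat.Primes => secondFactor c (p : ℕ))

end

/-! Both summands are values of a function $f$ of tuples that is multiplicative in all variables
jointly, with local coefficients $\tau(\sum\nu_i)$ or $\tau(\max\nu_i)$. Along each axis its local
series is $1+\sum_{k\ge1}\tau(k)X^k=1+X+2X^2+2X^3+3X^4+2X^5+\cdots$, which agrees through degree 4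
with $1/((1-X)(1-X^2))$, the local series of $\tau_{1,2}$. Hence
$f=h*(\tau_{1,2}\otimes\cdots\otimes\tau_{1,2})$ (`ofLocal_eq_tupleConv`), where the local
coefficients of $h$ vanish at pure powers $X_i^k$, $1\le k\le4$ (`localInv_single_eq_zero`).

A nonzero local coefficient of $h$ away from the origin is therefore a pure power of degree at least
5 or involves two variables. At the point with one coordinate $\theta$ and the others 1, its term is
$O(p^{-\min(5\theta,1+\theta)})$ for fixed $\nu$, so the Dirichlet series of $h$ converges
absolutely there for $1/5<\theta\le1$ (`summable_ofLocal_weight`). This is the origin of $1/5$ in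
$\theta_2^*$.

With $T(y)=\sum_{n\le y}\tau_{1,2}(n)$, the sum of $f$ equals $\sum_d h(d)\prod_i T(x/d_i)$.
Expanding $T(y)=\zeta(2)y+\zeta(1/2)y^{1/2}+O(y^\theta)$ and keeping at most one factor different
from $\zeta(2)y_i$ costs $O(\prod_i y_i\sum_i y_i^{\theta-1})$, uniformly in $y_i>0$
(`exists_prod_tauSum_bound`). Summation against $h$ gives both main terms and the error
$x^{r-1+\theta}$ (`exists_sum_tupleConv_bound`). The constants are values of the Dirichlet series of
$h$ times powers of $\zeta(2)$, rewritten as Euler products; symmetry in the variables makes the $r$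
secondary terms equal, whence the factor $r$. -/

noncomputable section

/-! ### Multiplicative functions of tuples and their Euler products. -/

/-- A function of `r`-tuples of natural numbers that vanishes when some entry is zero and is
multiplicative in all variables jointly. -/
structure IsTupleMult {r : ℕ} (f : (Fin r → ℕ) → ℝ) : Prop where
  map_one : f (fun _ => 1) = 1
  map_zero : ∀ d : Fin r → ℕ, (∃ i, d i = 0) → f d = 0
  map_mul : ∀ p : ℕ, p.Prime → ∀ ν m : Fin r → ℕ, (∀ i, ¬ p ∣ m i) →
    f (fun i => p ^ ν i * m i) = f (fun i => p ^ ν i) * f m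

namespace IsTupleMult

variable {r : ℕ} {f : (Fin r → ℕ) → ℝ}

theorem abs (hf : IsTupleMult f) : IsTupleMult fun d => |f d| where
  map_one := by simp [hf.map_one]
  map_zero d hd := by simp [hf.map_zero d hd]
  map_mul p hp ν m hm := by simp [hf.map_mul p hp ν m hm, abs_mul]

/-- Induction on the set of primes: adjoining a prime $p$ splits each coordinate uniquely into a
power of $p$ and a number composed of the earlier primes, so the series becomes a product of two
absolutely convergent ones. A nonprime element changes nothing. -/
theorem summable_and_hasSum_factored (hf : IsTupleMult f)
    (hsum : ∀ p : ℕ, p.Prime → Summable fun ν : Fin r → ℕ => |f fun i => p ^ ν i|)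
    (s : Finset ℕ) :
    Summable (fun m : Fin r → Nat.factoredNumbers s => |f fun i => (m i : ℕ)|) ∧
      HasSum (fun m : Fin r → Nat.factoredNumbers s => f fun i => (m i : ℕ))
        (∏ p ∈ s with p.Prime, ∑' ν : Fin r → ℕ, f fun i => p ^ ν i) := by
  induction s using Finset.induction with
  | empty =>
    have hval : ∀ (m : Fin r → Nat.factoredNumbers ∅), (fun i => (m i : ℕ)) = fun _ => 1 := by
      intro m
      funext i
      exact (Set.ext_iff.1 Nat.factoredNumbers_empty _).1 (m i).2
    let hun : Unique (Fin r → Nat.factoredNumbers ∅) :=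
      { default := fun _ => ⟨1, by rw [Nat.factoredNumbers_empty]; rfl⟩
        uniq := fun m => by
          funext i
          exact Subtype.ext (congrFun (hval m) i) }
    refine ⟨(hasSum_unique _).summable, ?_⟩
    have h := hasSum_unique (fun m : Fin r → Nat.factoredNumbers ∅ => f fun i => (m i : ℕ))
    rw [hval, hf.map_one] at h
    simpa using h
  | insert p s hp ih =>
    rw [Finset.filter_insert]
    split_ifs with hpp
    · let e : (Fin r → ℕ) × (Fin r → Nat.factoredNumbers s) ≃
          (Fin r → Nat.factoredNumbers (insert p s)) :=
        (Equiv.arrowProdEquivProdArrow (Fin r) (fun _ => ℕ)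
          (fun _ => Nat.factoredNumbers s)).symm.trans
          (Equiv.piCongrRight fun _ => Nat.equivProdNatFactoredNumbers hpp hp)
      have he : ∀ x, (fun i => ((e x i : Nat.factoredNumbers (insert p s)) : ℕ)) =
          fun i => p ^ x.1 i * (x.2 i : ℕ) := by
        intro x
        funext i
        simp [e, Nat.equivProdNatFactoredNumbers_apply']
      have hmul : ∀ x : (Fin r → ℕ) × (Fin r → Nat.factoredNumbers s),
          f (fun i => p ^ x.1 i * (x.2 i : ℕ)) = f (fun i => p ^ x.1 i) * f fun i => (x.2 i : ℕ) := by
        intro x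
        refine hf.map_mul p hpp _ _ fun i hdvd => ?_
        exact (Nat.Prime.coprime_iff_not_dvd hpp).1
          (hpp.factoredNumbers_coprime hp (x.2 i).2) hdvd
      constructor
      · rw [← e.summable_iff]
        simp only [Function.comp_def, he, hmul, abs_mul]
        exact (hsum p hpp).mul_of_nonneg ih.1 (fun _ => abs_nonneg _) (fun _ => abs_nonneg _)
      · have hp' : p ∉ {p ∈ s | p.Prime} := mt (Finset.mem_of_mem_filter p) hp
        rw [Finset.prod_insert hp', ← e.hasSum_iff]
        simp only [Function.comp_def, he, hmul]
        have h1 := (hsum p hpp).of_abs.hasSum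
        have h2 : Summable fun x : (Fin r → ℕ) × (Fin r → Nat.factoredNumbers s) =>
            f (fun i => p ^ x.1 i) * f fun i => (x.2 i : ℕ) :=
          summable_mul_of_summable_norm (f := fun ν : Fin r → ℕ => f fun i => p ^ ν i)
            (g := fun m : Fin r → Nat.factoredNumbers s => f fun i => (m i : ℕ)) (hsum p hpp) ih.1
        exact h1.mul ih.2 h2
    · rwa [Nat.factoredNumbers_insert s hpp]

theorem local_summable
    (hsum : Summable fun x : Nat.Primes × {ν : Fin r → ℕ // ν ≠ 0} =>
      |f fun i => (x.1 : ℕ) ^ x.2.1 i|) (p : Nat.Primes) :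
    Summable fun ν : Fin r → ℕ => |f fun i => (p : ℕ) ^ ν i| := by
  have h := hsum.prod_factor p
  have h2 := (Finset.summable_compl_iff ({0} : Finset (Fin r → ℕ))
    (f := fun ν : Fin r → ℕ => |f fun i => (p : ℕ) ^ ν i|)).1
  apply h2
  let e : {x : Fin r → ℕ // x ∉ ({0} : Finset (Fin r → ℕ))} ≃ {ν : Fin r → ℕ // ν ≠ 0} :=
    Equiv.subtypeEquivRight (by simp)
  rw [← e.symm.summable_iff]
  exact h

theorem tsum_local_eq (hf : IsTupleMult f) (p : ℕ)
    (hs : Summable fun ν : Fin r → ℕ => f fun i => p ^ ν i) :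
    ∑' ν : Fin r → ℕ, f (fun i => p ^ ν i) =
      1 + ∑' ν : {ν : Fin r → ℕ // ν ≠ 0}, f (fun i => p ^ ν.1 i) := by
  have h := hs.sum_add_tsum_subtype_compl {0}
  rw [← h]
  congr 1
  · simp [hf.map_one]
  · let e : {x : Fin r → ℕ // x ∉ ({0} : Finset (Fin r → ℕ))} ≃ {ν : Fin r → ℕ // ν ≠ 0} :=
      Equiv.subtypeEquivRight (by simp)
    exact e.tsum_eq (fun ν : {ν : Fin r → ℕ // ν ≠ 0} => f (fun i => p ^ ν.1 i))

/-- Absolute convergence of a multiple series of a multiplicative function follows from the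
convergence of the sum of the local terms. -/
theorem summable_abs (hf : IsTupleMult f)
    (hsum : Summable fun x : Nat.Primes × {ν : Fin r → ℕ // ν ≠ 0} =>
      |f fun i => (x.1 : ℕ) ^ x.2.1 i|) :
    Summable fun d => |f d| := by
  classical
  set G : Nat.Primes → ℝ := fun p => ∑' ν : {ν : Fin r → ℕ // ν ≠ 0}, |f fun i => (p : ℕ) ^ ν.1 i|
  have hG : Summable G := hsum.prod
  have hG0 : ∀ p, 0 ≤ G p := fun p => tsum_nonneg fun _ => abs_nonneg _
  refine summable_of_sum_le (c := Real.exp (∑' p, G p)) (fun _ => abs_nonneg _) fun T => ?_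
  set T' := T.filter fun d => ∀ i, d i ≠ 0
  have hTT : ∑ d ∈ T, |f d| = ∑ d ∈ T', |f d| := by
    refine (Finset.sum_filter_of_ne fun d _ hd i hi => hd ?_).symm
    simp [hf.map_zero d ⟨i, hi⟩]
  -- The primes occurring in `T'` are finitely many, so the partial sum over `T` is bounded by a
  -- finite Euler product.
  set S : Finset ℕ := T'.biUnion fun d => Finset.univ.biUnion fun i => (d i).primeFactors
  have hmem : ∀ d ∈ T', ∀ i, d i ∈ Nat.factoredNumbers S := by
    intro d hd i
    refine Nat.mem_factoredNumbers_of_primeFactors_subset ((Finset.mem_filter.1 hd).2 i) ?_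
    intro q hq
    exact Finset.mem_biUnion.2 ⟨d, hd, Finset.mem_biUnion.2 ⟨i, Finset.mem_univ _, hq⟩⟩
  have hloc : ∀ p : ℕ, p.Prime → Summable fun ν : Fin r → ℕ => |f fun i => p ^ ν i| :=
    fun p hp => local_summable hsum ⟨p, hp⟩
  obtain ⟨h1, h2⟩ := hf.abs.summable_and_hasSum_factored (by simpa using hloc) S
  let S' : Finset Nat.Primes := S.subtype Nat.Prime
  rw [hTT, ← Finset.sum_attach]
  have hinj : Set.InjOn (fun d : T' => (fun i => ⟨d.1 i, hmem d.1 d.2 i⟩ :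
      Fin r → Nat.factoredNumbers S)) (T'.attach : Finset T') := by
    intro a _ b _ hab
    apply Subtype.ext
    funext i
    exact congrArg Subtype.val (congrFun hab i)
  calc ∑ d ∈ T'.attach, |f d.1|
      = ∑ m ∈ T'.attach.image (fun d : T' => (fun i => ⟨d.1 i, hmem d.1 d.2 i⟩ :
          Fin r → Nat.factoredNumbers S)), |f fun i => (m i : ℕ)| := by
        rw [Finset.sum_image hinj]
    _ ≤ ∏ p ∈ S with p.Prime, ∑' ν : Fin r → ℕ, |f fun i => p ^ ν i| :=
        sum_le_hasSum _ (fun _ _ => abs_nonneg _) h2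
    _ = ∏ p ∈ S', (1 + G p) := by
        rw [← Finset.prod_subtype_eq_prod_filter]
        refine Finset.prod_congr rfl fun p _ => ?_
        exact hf.abs.tsum_local_eq p (hloc p p.2)
    _ ≤ Real.exp (∑ p ∈ S', G p) := Real.prod_one_add_le_exp_sum _ hG0
    _ ≤ Real.exp (∑' p, G p) := Real.exp_le_exp.2 (sum_le_hasSum _ (fun p _ => hG0 p) hG.hasSum)

/-- The Euler product of an absolutely convergent multiple series of a multiplicative function. -/
theorem hasProd (hf : IsTupleMult f) (hsum : Summable fun d => |f d|) :
    HasProd (fun p : Nat.Primes => ∑' ν : Fin r → ℕ, f fun i => (p : ℕ) ^ ν i) (∑' d, f d) := by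
  classical
  have hinj : ∀ p : ℕ, p.Prime → Function.Injective fun (ν : Fin r → ℕ) (i : Fin r) => p ^ ν i := by
    intro p hp a b hab
    funext i
    exact Nat.pow_right_injective hp.two_le (congrFun hab i)
  have hloc : ∀ p : ℕ, p.Prime → Summable fun ν : Fin r → ℕ => |f fun i => p ^ ν i| :=
    fun p hp => hsum.comp_injective (hinj p hp)
  let Q : Finset Nat.Primes → Set (Fin r → ℕ) :=
    fun s => {d | ∀ i, d i ∈ Nat.factoredNumbers (s.image fun p : Nat.Primes => (p : ℕ))}
  have hprod : ∀ s : Finset Nat.Primes,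
      ∏ p ∈ s, ∑' ν : Fin r → ℕ, f (fun i => (p : ℕ) ^ ν i) = ∑' d, (Q s).indicator f d := by
    intro s
    have h := (hf.summable_and_hasSum_factored hloc (s.image fun p : Nat.Primes => (p : ℕ))).2
    have hfil : (s.image fun p : Nat.Primes => (p : ℕ)).filter Nat.Prime =
        s.image fun p : Nat.Primes => (p : ℕ) := by
      refine Finset.filter_true_of_mem fun p hp => ?_
      obtain ⟨q, _, rfl⟩ := Finset.mem_image.1 hp
      exact q.2
    rw [hfil, Finset.prod_image (g := fun p : Nat.Primes => (p : ℕ)) (fun a _ b _ hab => Subtype.ext hab)] at h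
    rw [← h.tsum_eq, ← tsum_subtype]
    let e : (Fin r → Nat.factoredNumbers (s.image fun p : Nat.Primes => (p : ℕ))) ≃ Q s :=
      { toFun := fun m => ⟨fun i => m i, fun i => (m i).2⟩
        invFun := fun d i => ⟨d.1 i, d.2 i⟩
        left_inv := fun _ => rfl
        right_inv := fun _ => rfl }
    exact (e.tsum_eq fun d : Q s => f d)
  rw [HasProd, SummationFilter.unconditional_filter]
  simp_rw [hprod]
  -- Each tuple with nonzero entries lies in `Q s` once `s` contains its primes, so the indicators
  -- converge pointwise under the summable bound $|f|$.
  refine tendsto_tsum_of_dominated_convergence hsum (fun d => ?_) ?_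
  · by_cases hd : ∃ i, d i = 0
    · have : ∀ s, (Q s).indicator f d = f d := by
        intro s
        simp [Set.indicator_apply, hf.map_zero d hd]
      simp [this]
    · push Not at hd
      let s0 : Finset Nat.Primes :=
        (Finset.univ.biUnion fun i => (d i).primeFactors).subtype Nat.Prime
      refine tendsto_const_nhds.congr' ?_
      filter_upwards [eventually_ge_atTop s0] with s hs
      rw [Set.indicator_of_mem]
      intro i
      refine Nat.mem_factoredNumbers_of_primeFactors_subset (hd i) fun q hq => ?_
      refine Finset.mem_image.2 ⟨⟨q, Nat.prime_of_mem_primeFactors hq⟩, hs ?_, rfl⟩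
      exact Finset.mem_subtype.2 (Finset.mem_biUnion.2 ⟨i, Finset.mem_univ _, hq⟩)
  · refine Eventually.of_forall fun s d => ?_
    exact (norm_indicator_le_norm_self _ _)

end IsTupleMult

/-! ### Multiplicative functions with prescribed local coefficients. -/

variable {r : ℕ}

/-- The multiplicative function of tuples whose value at `(p ^ ν₁, …, p ^ ν_r)` is `B ν`. -/
def ofLocal (B : (Fin r → ℕ) → ℝ) (d : Fin r → ℕ) : ℝ :=
  if ∃ i, d i = 0 then 0 else ∏ p ∈ (∏ i, d i).primeFactors, B fun i => (d i).factorization p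

/-- Extra elements of `S` contribute `B 0 = 1`, so a common set of primes can serve all coordinates.
-/
theorem ofLocal_eq_prod {B : (Fin r → ℕ) → ℝ} (hB : B 0 = 1) {d : Fin r → ℕ}
    (hd : ∀ i, d i ≠ 0) {S : Finset ℕ} (hS : ∀ i, (d i).primeFactors ⊆ S) :
    ofLocal B d = ∏ p ∈ S, B fun i => (d i).factorization p := by
  have hne : ∏ i, d i ≠ 0 := Finset.prod_ne_zero_iff.2 fun i _ => hd i
  rw [ofLocal, if_neg (by push Not; exact hd)]
  apply Finset.prod_subset
  · intro p hp
    obtain ⟨hp1, hp2, -⟩ := Nat.mem_primeFactors.1 hp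
    obtain ⟨i, -, hi⟩ := (hp1.prime.dvd_finsetProd_iff _).1 hp2
    exact hS i (Nat.mem_primeFactors.2 ⟨hp1, hi, hd i⟩)
  · intro p _ hp
    rw [← hB]
    congr 1
    funext i
    by_cases hpp : p.Prime
    · refine Nat.factorization_eq_zero_of_not_dvd fun h => hp ?_
      exact Nat.mem_primeFactors.2 ⟨hpp, h.trans (Finset.dvd_prod_of_mem d (Finset.mem_univ i)), hne⟩
    · exact Nat.factorization_eq_zero_of_not_prime _ hpp

theorem primeFactors_prime_pow_subset {p : ℕ} (hp : p.Prime) (k : ℕ) :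
    (p ^ k).primeFactors ⊆ {p} := fun _ hq => Finset.mem_singleton.2
  (Nat.prime_eq_prime_of_dvd_pow (Nat.prime_of_mem_primeFactors hq) hp
    (Nat.dvd_of_mem_primeFactors hq))

theorem ofLocal_pow {B : (Fin r → ℕ) → ℝ} (hB : B 0 = 1) {p : ℕ} (hp : p.Prime)
    (ν : Fin r → ℕ) : ofLocal B (fun i => p ^ ν i) = B ν := by
  rw [ofLocal_eq_prod hB (S := {p}) (fun i => pow_ne_zero _ hp.ne_zero)
    (fun i => primeFactors_prime_pow_subset hp _)]
  simp [hp.factorization_self]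

theorem isTupleMult_ofLocal {B : (Fin r → ℕ) → ℝ} (hB : B 0 = 1) : IsTupleMult (ofLocal B) where
  map_one := by
    rw [ofLocal_eq_prod hB (S := ∅) (by simp) (by simp)]
    simp
  map_zero d hd := by simp [ofLocal, hd]
  map_mul p hp ν m hm := by
    classical
    have hm0 : ∀ i, m i ≠ 0 := fun i h => hm i (by simp [h])
    set S := Finset.univ.biUnion fun i => (m i).primeFactors
    have hpS : p ∉ S := by
      simp only [S, Finset.mem_biUnion, not_exists, not_and]
      exact fun i _ h => hm i (Nat.dvd_of_mem_primeFactors h)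
    have hmS : ∀ i, (m i).primeFactors ⊆ S := fun i =>
      Finset.subset_biUnion_of_mem (fun i => (m i).primeFactors) (Finset.mem_univ i)
    have hfac : ∀ q i, (p ^ ν i * m i).factorization q =
        (if q = p then ν i else 0) + (m i).factorization q := by
      intro q i
      rw [Nat.factorization_mul (pow_ne_zero _ hp.ne_zero) (hm0 i), hp.factorization_pow]
      simp [Finsupp.single_apply, eq_comm]
    rw [ofLocal_pow hB hp, ofLocal_eq_prod hB hm0 hmS, ofLocal_eq_prod hB (S := insert p S)
      (fun i => mul_ne_zero (pow_ne_zero _ hp.ne_zero) (hm0 i)), Finset.prod_insert hpS]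
    · congr 1
      · congr 1
        funext i
        simp [hfac, Nat.factorization_eq_zero_of_not_dvd (hm i)]
      · refine Finset.prod_congr rfl fun q hq => ?_
        have : q ≠ p := fun h => hpS (h ▸ hq)
        simp [hfac, this]
    · intro i
      rw [Nat.primeFactors_mul (pow_ne_zero _ hp.ne_zero) (hm0 i)]
      refine Finset.union_subset ?_ ((hmS i).trans (Finset.subset_insert _ _))
      exact (primeFactors_prime_pow_subset hp _).trans (by simp)

/-- A multiplicative function of tuples is determined by its values at powers of one prime. -/
theorem IsTupleMult.eq_of_pow {f g : (Fin r → ℕ) → ℝ} (hf : IsTupleMult f) (hg : IsTupleMult g)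
    (h : ∀ p : ℕ, p.Prime → ∀ ν : Fin r → ℕ, f (fun i => p ^ ν i) = g fun i => p ^ ν i) :
    f = g := by
  have key : ∀ N : ℕ, ∀ d : Fin r → ℕ, (∀ i, d i ≠ 0) → ∏ i, d i = N → f d = g d := by
    intro N
    induction N using Nat.strong_induction_on with
    | _ N ih =>
      intro d hd hN
      by_cases h1 : N = 1
      · have : d = fun _ => 1 := by
          funext i
          exact Nat.dvd_one.1 (h1 ▸ hN ▸ Finset.dvd_prod_of_mem d (Finset.mem_univ i))
        rw [this, hf.map_one, hg.map_one]
      · obtain ⟨p, hp, hpN⟩ := Nat.exists_prime_and_dvd h1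
        have hsplit : d = fun i => p ^ (d i).factorization p * (d i / p ^ (d i).factorization p) := by
          funext i
          exact (Nat.ordProj_mul_ordCompl_eq_self _ _).symm
        have hnd : ∀ i, ¬ p ∣ d i / p ^ (d i).factorization p :=
          fun i => Nat.not_dvd_ordCompl hp (hd i)
        have hpos : ∀ i, d i / p ^ (d i).factorization p ≠ 0 := fun i hi => hnd i (by simp [hi])
        rw [hsplit, hf.map_mul p hp _ _ hnd, hg.map_mul p hp _ _ hnd, h p hp]
        congr 1
        -- Removing the $p$-parts strictly decreases the product of the entries, since $p$ divides
        -- at least one of them.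
        refine ih _ ?_ _ hpos rfl
        rw [← hN] at hpN ⊢
        obtain ⟨j, -, hj⟩ := (hp.prime.dvd_finsetProd_iff _).1 hpN
        refine Finset.prod_lt_prod (fun i _ => Nat.pos_of_ne_zero (hpos i))
          (fun i _ => Nat.div_le_self _ _) ⟨j, Finset.mem_univ _, ?_⟩
        refine Nat.div_lt_self (Nat.pos_of_ne_zero (hd j)) (Nat.one_lt_pow ?_ hp.one_lt)
        exact (hp.factorization_pos_of_dvd (hd j) hj).ne'
  funext d
  by_cases hd : ∃ i, d i = 0
  · rw [hf.map_zero d hd, hg.map_zero d hd]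
  · push Not at hd
    exact key _ d hd rfl

/-! ### Dirichlet convolution of functions of tuples. -/

/-- The Dirichlet convolution of two functions of tuples. -/
def tupleConv (f g : (Fin r → ℕ) → ℝ) (n : Fin r → ℕ) : ℝ :=
  ∑ d ∈ Fintype.piFinset fun i => (n i).divisors, f d * g fun i => n i / d i

/-- The tuples of exponents bounded by `ν`. -/
def expBox (ν : Fin r → ℕ) : Finset (Fin r → ℕ) :=
  Fintype.piFinset fun i => Finset.range (ν i + 1)

theorem mem_expBox {ν β : Fin r → ℕ} : β ∈ expBox ν ↔ ∀ i, β i ≤ ν i := by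
  simp [expBox]

/-- The $p$-part and the prime-to-$p$ part of a divisor vary independently. This is what makes
convolution preserve multiplicativity. -/
theorem sum_divisors_tuple_pow_mul {p : ℕ} (hp : p.Prime) (ν m : Fin r → ℕ) (hm : ∀ i, ¬ p ∣ m i)
    (φ : (Fin r → ℕ) → ℝ) :
    ∑ d ∈ Fintype.piFinset fun i => (p ^ ν i * m i).divisors, φ d =
      ∑ α ∈ expBox ν, ∑ d ∈ Fintype.piFinset fun i => (m i).divisors,
        φ fun i => p ^ α i * d i := by
  have hm0 : ∀ i, m i ≠ 0 := fun i h => hm i (by simp [h])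
  rw [← Finset.sum_product']
  have hfac : ∀ (k d : ℕ), ¬ p ∣ d → (p ^ k * d).factorization p = k := by
    intro k d hd
    have hd0 : d ≠ 0 := fun h => hd (by simp [h])
    rw [Nat.factorization_mul (pow_ne_zero _ hp.ne_zero) hd0, hp.factorization_pow]
    simp [Nat.factorization_eq_zero_of_not_dvd hd]
  symm
  refine Finset.sum_nbij' (fun x i => p ^ x.1 i * x.2 i)
    (fun d => (fun i => (d i).factorization p, fun i => d i / p ^ (d i).factorization p))
    ?_ ?_ ?_ ?_ ?_
  · rintro ⟨α, d⟩ h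
    simp only [Finset.mem_product, mem_expBox, Fintype.mem_piFinset, Nat.mem_divisors] at h ⊢
    exact fun i => ⟨Nat.mul_dvd_mul (pow_dvd_pow _ (h.1 i)) (h.2 i).1,
      mul_ne_zero (pow_ne_zero _ hp.ne_zero) (hm0 i)⟩
  · intro d h
    simp only [Finset.mem_product, mem_expBox, Fintype.mem_piFinset, Nat.mem_divisors] at h ⊢
    have hd0 : ∀ i, d i ≠ 0 := fun i => ne_zero_of_dvd_ne_zero (h i).2 (h i).1
    constructor
    · intro i
      have := (Nat.factorization_le_iff_dvd (hd0 i) (h i).2).2 (h i).1 p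
      rwa [hfac _ _ (hm i)] at this
    · intro i
      refine ⟨?_, hm0 i⟩
      have hco : Nat.Coprime (d i / p ^ (d i).factorization p) (p ^ ν i) :=
        (Nat.coprime_ordCompl hp (hd0 i)).symm.pow_right _
      exact hco.dvd_of_dvd_mul_left ((Nat.ordCompl_dvd _ _).trans (h i).1)
  · rintro ⟨α, d⟩ h
    simp only [Finset.mem_product, mem_expBox, Fintype.mem_piFinset, Nat.mem_divisors] at h
    have hd : ∀ i, ¬ p ∣ d i := fun i hi => hm i (hi.trans (h.2 i).1)
    ext i
    · exact hfac _ _ (hd i)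
    · simp only [hfac _ _ (hd i)]
      exact Nat.mul_div_cancel_left _ (pow_pos hp.pos _)
  · intro d _
    funext i
    exact Nat.ordProj_mul_ordCompl_eq_self _ _
  · intros
    rfl

theorem tupleConv_pow {p : ℕ} (hp : p.Prime) (f g : (Fin r → ℕ) → ℝ) (ν : Fin r → ℕ) :
    tupleConv f g (fun i => p ^ ν i) =
      ∑ α ∈ expBox ν, f (fun i => p ^ α i) * g fun i => p ^ (ν i - α i) := by
  have h := sum_divisors_tuple_pow_mul hp ν (fun _ => 1) (fun _ => hp.one_lt.ne' ∘ Nat.dvd_one.1)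
    fun d => f d * g fun i => p ^ ν i / d i
  simp only [mul_one, Nat.divisors_one, Fintype.piFinset_singleton, Finset.sum_singleton] at h
  rw [tupleConv, h]
  refine Finset.sum_congr rfl fun α hα => ?_
  congr 2
  funext i
  exact Nat.pow_div (mem_expBox.1 hα i) hp.pos

theorem IsTupleMult.tupleConv {f g : (Fin r → ℕ) → ℝ} (hf : IsTupleMult f) (hg : IsTupleMult g) :
    IsTupleMult (tupleConv f g) where
  map_one := by
    simp [_root_.tupleConv, hf.map_one, hg.map_one]
  map_zero n := by
    rintro ⟨i, hi⟩
    have : Fintype.piFinset (fun i => (n i).divisors) = ∅ :=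
      Finset.eq_empty_of_forall_notMem fun d hd => by
        simpa [hi] using Fintype.mem_piFinset.1 hd i
    simp [_root_.tupleConv, this]
  map_mul p hp ν m hm := by
    rw [tupleConv_pow hp, _root_.tupleConv, sum_divisors_tuple_pow_mul hp ν m hm,
      _root_.tupleConv, Finset.sum_mul]
    refine Finset.sum_congr rfl fun α hα => ?_
    rw [Finset.mul_sum]
    refine Finset.sum_congr rfl fun d hd => ?_
    have hdm : ∀ i, d i ∣ m i := fun i => Nat.dvd_of_mem_divisors (Fintype.mem_piFinset.1 hd i)
    have h1 : (fun i => p ^ ν i * m i / (p ^ α i * d i)) =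
        fun i => p ^ (ν i - α i) * (m i / d i) := by
      funext i
      rw [Nat.mul_div_mul_comm (pow_dvd_pow _ (mem_expBox.1 hα i)) (hdm i),
        Nat.pow_div (mem_expBox.1 hα i) hp.pos]
    rw [hf.map_mul p hp α d fun i hi => hm i (hi.trans (hdm i)), h1,
      hg.map_mul p hp _ _ fun i hi => hm i (hi.trans (Nat.div_dvd_of_dvd (hdm i)))]
    ring

/-! ### The function $\tau_{1,2}$ on tuples. -/

theorem tauOne_two_eq_sum (n : ℕ) :
    (tauOne 2 n : ℝ) = ∑ d ∈ n.divisors, if d ^ 2 ∣ n then (1 : ℝ) else 0 := by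
  rw [Finset.sum_boole, tauOne]
  norm_cast
  refine Finset.card_nbij' (fun ab => ab.2) (fun d => (n / d ^ 2, d)) ?_ ?_ ?_ ?_
  · rintro ⟨a, b⟩ h
    simp only [Finset.coe_filter, Finset.mem_product, Set.mem_ofPred_eq] at h ⊢
    exact ⟨h.1.2, h.2 ▸ dvd_mul_left _ _⟩
  · intro d h
    simp only [Finset.coe_filter, Finset.mem_product, Set.mem_ofPred_eq, Nat.mem_divisors] at h ⊢
    exact ⟨⟨⟨Nat.div_dvd_of_dvd h.2, h.1.2⟩, h.1⟩, Nat.div_mul_cancel h.2⟩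
  · rintro ⟨a, b⟩ h
    simp only [Finset.coe_filter, Finset.mem_product, Set.mem_ofPred_eq, Nat.mem_divisors] at h ⊢
    have hb : 0 < b := Nat.pos_of_dvd_of_pos h.1.2.1 (Nat.pos_of_ne_zero h.1.2.2)
    rw [← h.2, Nat.mul_div_cancel _ (by positivity)]
  · intro d _
    rfl

/-- The function `∏ τ_{1,2}(n_i)` of tuples. -/
def tauTuple (n : Fin r → ℕ) : ℝ := ∏ i, (tauOne 2 (n i) : ℝ)

theorem pow_mul_sq_dvd_iff {p : ℕ} (hp : p.Prime) {a k d m : ℕ} (hd : ¬ p ∣ d) (hm : ¬ p ∣ m) :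
    (p ^ a * d) ^ 2 ∣ p ^ k * m ↔ 2 * a ≤ k ∧ d ^ 2 ∣ m := by
  have hpd : Nat.Coprime d p := ((Nat.Prime.coprime_iff_not_dvd hp).2 hd).symm
  have hpm : Nat.Coprime p m := (Nat.Prime.coprime_iff_not_dvd hp).2 hm
  rw [mul_pow, ← pow_mul, mul_comm a 2]
  constructor
  · intro h
    refine ⟨?_, ?_⟩
    · have h1 : p ^ (2 * a) ∣ p ^ k :=
        (hpm.pow_left _).dvd_of_dvd_mul_right ((dvd_mul_right _ _).trans h)
      exact (Nat.pow_dvd_pow_iff_le_right hp.one_lt).1 h1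
    · exact (Nat.Coprime.pow 2 k hpd).dvd_of_dvd_mul_left ((dvd_mul_left _ _).trans h)
  · rintro ⟨h1, h2⟩
    exact Nat.mul_dvd_mul (pow_dvd_pow _ h1) h2

/-- The left side counts the $a$ with $p^{2a}\mid p^k$, so this evaluates $\tau_{1,2}(p^k)$, the
coefficient of $X^k$ in $1/((1-X)(1-X^2))$. -/
theorem sum_range_two_mul_le (k : ℕ) :
    (∑ a ∈ Finset.range (k + 1), if 2 * a ≤ k then (1 : ℝ) else 0) = ((k / 2 + 1 : ℕ) : ℝ) := by
  rw [Finset.sum_boole]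
  have : (Finset.range (k + 1)).filter (fun a => 2 * a ≤ k) = Finset.range (k / 2 + 1) := by
    ext a
    simp only [Finset.mem_filter, Finset.mem_range]
    omega
  rw [this, Finset.card_range]

theorem tauTuple_eq_sum (n : Fin r → ℕ) :
    tauTuple n = ∑ d ∈ Fintype.piFinset fun i => (n i).divisors,
      ∏ i, if d i ^ 2 ∣ n i then (1 : ℝ) else 0 := by
  simp_rw [tauTuple, tauOne_two_eq_sum]
  exact Finset.prod_univ_sum _ _

theorem tauTuple_pow_mul {p : ℕ} (hp : p.Prime) (ν m : Fin r → ℕ) (hm : ∀ i, ¬ p ∣ m i) :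
    tauTuple (fun i => p ^ ν i * m i) = (∏ i, ((ν i / 2 + 1 : ℕ) : ℝ)) * tauTuple m := by
  rw [tauTuple_eq_sum, tauTuple_eq_sum, sum_divisors_tuple_pow_mul hp ν m hm]
  simp_rw [← sum_range_two_mul_le]
  rw [Finset.prod_univ_sum, Finset.sum_mul]
  refine Finset.sum_congr rfl fun α _ => ?_
  rw [Finset.mul_sum]
  refine Finset.sum_congr rfl fun d hd => ?_
  rw [← Finset.prod_mul_distrib]
  refine Finset.prod_congr rfl fun i _ => ?_
  have hdm : d i ∣ m i := Nat.dvd_of_mem_divisors (Fintype.mem_piFinset.1 hd i)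
  rw [if_congr (pow_mul_sq_dvd_iff hp (fun h => hm i (h.trans hdm)) (hm i)) rfl rfl, ite_and]
  split_ifs <;> simp

theorem tauTuple_one : tauTuple (fun _ : Fin r => 1) = 1 := by
  simp [tauTuple, tauOne_two_eq_sum]

theorem tauTuple_pow {p : ℕ} (hp : p.Prime) (ν : Fin r → ℕ) :
    tauTuple (fun i => p ^ ν i) = ∏ i, ((ν i / 2 + 1 : ℕ) : ℝ) := by
  have h := tauTuple_pow_mul hp ν (fun _ => 1) (fun _ => hp.one_lt.ne' ∘ Nat.dvd_one.1)
  simpa [tauTuple_one] using h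

theorem isTupleMult_tauTuple : IsTupleMult (tauTuple (r := r)) where
  map_one := tauTuple_one
  map_zero d := by
    rintro ⟨i, hi⟩
    exact Finset.prod_eq_zero (Finset.mem_univ i) (by simp [tauOne, hi])
  map_mul p hp ν m hm := by rw [tauTuple_pow_mul hp ν m hm, tauTuple_pow hp]

/-! ### Local division by the series of $\tau_{1,2}$. -/

/-- The coefficients of `(1 - X) (1 - X ^ 2)`. -/
def invCoeff (k : ℕ) : ℝ :=
  if k = 0 then 1 else if k = 1 then -1 else if k = 2 then -1 else if k = 3 then 1 else 0

theorem invCoeff_zero : invCoeff 0 = 1 := by simp [invCoeff]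
theorem invCoeff_one : invCoeff 1 = -1 := by simp [invCoeff]
theorem invCoeff_two : invCoeff 2 = -1 := by simp [invCoeff]
theorem invCoeff_three : invCoeff 3 = 1 := by simp [invCoeff]
theorem invCoeff_add_four (k : ℕ) : invCoeff (k + 4) = 0 := by simp [invCoeff]

theorem abs_invCoeff_le (k : ℕ) : |invCoeff k| ≤ 1 := by
  unfold invCoeff
  split_ifs <;> simp

/-- This is the power series identity $(1-X)(1-X^2)\cdot\frac{1}{(1-X)(1-X^2)}=1$, read
coefficientwise. -/
theorem sum_invCoeff_mul (k : ℕ) :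
    ∑ b ∈ Finset.range (k + 1), invCoeff b * (((k - b) / 2 + 1 : ℕ) : ℝ) =
      if k = 0 then 1 else 0 := by
  match k with
  | 0 => simp [invCoeff_zero]
  | 1 => simp [Finset.sum_range_succ, invCoeff_zero, invCoeff_one]
  | 2 => simp [Finset.sum_range_succ, invCoeff_zero, invCoeff_one, invCoeff_two]
  | n + 3 =>
    have h : (((n + 3) / 2 : ℕ) : ℝ) + ((n / 2 : ℕ) : ℝ) =
        (((n + 2) / 2 : ℕ) : ℝ) + (((n + 1) / 2 : ℕ) : ℝ) := by
      norm_cast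
      omega
    simp only [Finset.sum_range_succ', invCoeff_add_four, zero_mul, Finset.sum_const_zero]
    simp only [zero_add, Nat.reduceAdd, invCoeff_zero, invCoeff_one, invCoeff_two, invCoeff_three,
      Nat.add_sub_cancel, Nat.sub_zero, show n + 3 - 2 = n + 1 by omega,
      show n + 3 - 1 = n + 2 by omega]
    rw [if_neg (by omega)]
    push_cast
    linarith

/-- The coefficients of the product of the series with coefficients `A` and
`∏ (1 - X_i) (1 - X_i ^ 2)`. -/
def localInv (A : (Fin r → ℕ) → ℝ) (ν : Fin r → ℕ) : ℝ :=
  ∑ β ∈ expBox ν, (∏ i, invCoeff (β i)) * A (ν - β)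

theorem localInv_zero {A : (Fin r → ℕ) → ℝ} (hA : A 0 = 1) : localInv A 0 = 1 := by
  have : expBox (0 : Fin r → ℕ) = {0} := by
    ext β
    simp [mem_expBox, funext_iff]
  simp [localInv, this, invCoeff_zero, hA]

/-- Multiplying by $\prod_i(1-X_i)(1-X_i^2)$ and then by its inverse restores the series of `A`. In
the double sum, the substitution $\gamma=\alpha-\beta$ isolates the argument of `A`, and the sum
over $\beta$ collapses to $\delta_{\gamma\nu}$. -/
theorem sum_localInv_mul (A : (Fin r → ℕ) → ℝ) (ν : Fin r → ℕ) :
    ∑ α ∈ expBox ν, localInv A α * ∏ i, (((ν i - α i) / 2 + 1 : ℕ) : ℝ) = A ν := by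
  have hinner : ∀ γ : Fin r → ℕ, ∑ β ∈ expBox (ν - γ), (∏ i, invCoeff (β i)) *
      ∏ i, (((ν i - γ i - β i) / 2 + 1 : ℕ) : ℝ) = ∏ i, if ν i - γ i = 0 then 1 else 0 := by
    intro γ
    simp_rw [← Finset.prod_mul_distrib, ← sum_invCoeff_mul, Finset.prod_univ_sum]
    rfl
  calc ∑ α ∈ expBox ν, localInv A α * ∏ i, (((ν i - α i) / 2 + 1 : ℕ) : ℝ)
      = ∑ x ∈ (expBox ν).sigma fun α => expBox α, (∏ i, invCoeff (x.2 i)) * A (x.1 - x.2) *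
          ∏ i, (((ν i - x.1 i) / 2 + 1 : ℕ) : ℝ) := by
        rw [Finset.sum_sigma]
        simp_rw [localInv, Finset.sum_mul]
    _ = ∑ x ∈ (expBox ν).sigma fun γ => expBox (ν - γ), A x.1 * ((∏ i, invCoeff (x.2 i)) *
          ∏ i, (((ν i - x.1 i - x.2 i) / 2 + 1 : ℕ) : ℝ)) := by
        refine Finset.sum_nbij' (fun x => ⟨x.1 - x.2, x.2⟩) (fun x => ⟨x.1 + x.2, x.2⟩)
          ?_ ?_ ?_ ?_ ?_
        · rintro ⟨α, β⟩ h
          simp only [Finset.mem_sigma, mem_expBox, Pi.sub_apply] at h ⊢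
          exact ⟨fun i => by have := h.1 i; omega, fun i => by have := h.1 i; have := h.2 i; omega⟩
        · rintro ⟨α, β⟩ h
          simp only [Finset.mem_sigma, mem_expBox, Pi.sub_apply, Pi.add_apply] at h ⊢
          exact ⟨fun i => by have := h.1 i; have := h.2 i; omega, fun i => by omega⟩
        · rintro ⟨α, β⟩ h
          simp only [Finset.mem_sigma, mem_expBox] at h
          have : α - β + β = α := tsub_add_cancel_of_le h.2
          simp [this]
        · rintro ⟨α, β⟩ h
          simp
        · rintro ⟨α, β⟩ h
          simp only [Finset.mem_sigma, mem_expBox] at h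
          have : ∀ i, ν i - (α - β) i - β i = ν i - α i := fun i => by
            have := h.2 i
            simp only [Pi.sub_apply]
            omega
          simp only [this]
          ring
    _ = ∑ γ ∈ expBox ν, A γ * ∏ i, if ν i - γ i = 0 then 1 else 0 := by
        rw [Finset.sum_sigma]
        refine Finset.sum_congr rfl fun γ _ => ?_
        simp only [← Finset.mul_sum, hinner]
    _ = A ν := by
        rw [Finset.sum_eq_single ν]
        · simp
        · intro γ hγ hne
          have : ∃ i, ν i - γ i ≠ 0 := by
            by_contra! hcon
            refine hne (funext fun i => ?_)
            have := mem_expBox.1 hγ i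
            have := hcon i
            omega
          obtain ⟨i, hi⟩ := this
          rw [Finset.prod_eq_zero (Finset.mem_univ i) (by simp [hi]), mul_zero]
        · intro h
          exact absurd (mem_expBox.2 fun i => le_rfl) h

theorem ofLocal_eq_tupleConv {A : (Fin r → ℕ) → ℝ} (hA : A 0 = 1) :
    ofLocal A = tupleConv (ofLocal (localInv A)) tauTuple := by
  have hB := localInv_zero hA
  refine (isTupleMult_ofLocal hA).eq_of_pow
    ((isTupleMult_ofLocal hB).tupleConv isTupleMult_tauTuple) fun p hp ν => ?_
  rw [tupleConv_pow hp, ofLocal_pow hA hp]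
  simp_rw [ofLocal_pow hB hp, tauTuple_pow hp]
  exact (sum_localInv_mul A ν).symm

/-- `invCoeff` is bounded by 1 and supported on $\{0,1,2,3\}$, so at most $4^r$ shifts of `A`
contribute. -/
theorem abs_localInv_le {A : (Fin r → ℕ) → ℝ} (hA : ∀ ν, |A ν| ≤ ∑ i, (ν i : ℝ) + 1)
    (ν : Fin r → ℕ) : |localInv A ν| ≤ 4 ^ r * (∑ i, (ν i : ℝ) + 1) := by
  have h1 : ∀ β : Fin r → ℕ, |∏ i, invCoeff (β i)| ≤
      if β ∈ Fintype.piFinset (fun _ : Fin r => Finset.range 4) then 1 else 0 := by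
    intro β
    split_ifs with h
    · rw [Finset.abs_prod]
      exact Finset.prod_le_one (fun _ _ => abs_nonneg _) fun i _ => abs_invCoeff_le _
    · simp only [Fintype.mem_piFinset, Finset.mem_range, not_forall, not_lt] at h
      obtain ⟨i, hi⟩ := h
      obtain ⟨k, hk⟩ := Nat.exists_eq_add_of_le' hi
      rw [Finset.prod_eq_zero (Finset.mem_univ i) (by rw [hk, invCoeff_add_four]), abs_zero]
  have h0 : (0 : ℝ) ≤ ∑ i, (ν i : ℝ) + 1 := by positivity
  calc |localInv A ν| ≤ ∑ β ∈ expBox ν, |(∏ i, invCoeff (β i)) * A (ν - β)| :=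
        Finset.abs_sum_le_sum_abs _ _
    _ ≤ ∑ β ∈ expBox ν, (if β ∈ Fintype.piFinset (fun _ : Fin r => Finset.range 4)
          then (1 : ℝ) else 0) * (∑ i, (ν i : ℝ) + 1) := by
        refine Finset.sum_le_sum fun β _ => ?_
        rw [abs_mul]
        refine mul_le_mul (h1 β) ((hA _).trans ?_) (abs_nonneg _) (by split_ifs <;> simp)
        gcongr with i
        exact Nat.sub_le _ _
    _ ≤ 4 ^ r * (∑ i, (ν i : ℝ) + 1) := by
        rw [← Finset.sum_mul]
        refine mul_le_mul_of_nonneg_right ?_ h0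
        rw [Finset.sum_boole]
        have : ((expBox ν).filter fun β => β ∈ Fintype.piFinset fun _ : Fin r => Finset.range 4).card
            ≤ 4 ^ r := by
          refine (Finset.card_le_card (t := Fintype.piFinset fun _ : Fin r => Finset.range 4)
            fun β hβ => (Finset.mem_filter.1 hβ).2).trans ?_
          simp
        exact_mod_cast this

theorem localInv_single (A : (Fin r → ℕ) → ℝ) (i : Fin r) (k : ℕ) :
    localInv A (Pi.single i k) =
      ∑ b ∈ Finset.range (k + 1), invCoeff b * A (Pi.single i (k - b)) := by
  symm
  refine Finset.sum_nbij' (fun b => Pi.single i b) (fun β => β i) ?_ ?_ ?_ ?_ ?_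
  · intro b hb
    rw [mem_expBox]
    intro j
    have := Finset.mem_range.1 hb
    by_cases h : j = i
    · subst h
      simp
      omega
    · simp [h]
  · intro β hβ
    have := mem_expBox.1 hβ i
    simp at this ⊢
    omega
  · intro b _
    simp
  · intro β hβ
    funext j
    by_cases h : j = i
    · subst h
      simp
    · have := mem_expBox.1 hβ j
      simp [h] at this
      simp [h, this]
  · intro b _
    have hsub : (Pi.single i k - Pi.single i b : Fin r → ℕ) = Pi.single i (k - b) := by
      funext j
      by_cases h : j = i
      · subst h
        simp
      · simp [h]
    rw [Finset.prod_eq_single i (fun j _ h => by simp [h, invCoeff_zero]) (by simp), hsub,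
      Pi.single_eq_same]

/-- The coefficients $1,1,2,2,3$ of $1+\sum_{k\ge1}\tau(k)X^k$ are also those of $1/((1-X)(1-X^2))$
in degrees 0 to 4. In degree 5 they are 2 and 3, so the range of `k` cannot be extended. -/
theorem localInv_single_eq_zero {A : (Fin r → ℕ) → ℝ} (hA0 : A 0 = 1)
    (hA : ∀ i, ∀ k ≠ 0, A (Pi.single i k) = (k.divisors.card : ℝ)) (i : Fin r) {k : ℕ}
    (hk : 1 ≤ k) (hk4 : k ≤ 4) : localInv A (Pi.single i k) = 0 := by
  have d2 : (Nat.divisors 2).card = 2 := by decide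
  have d3 : (Nat.divisors 3).card = 2 := by decide
  have d4 : (Nat.divisors 4).card = 3 := by decide
  have h0 : A (Pi.single i 0) = 1 := by rw [Pi.single_zero, hA0]
  rw [localInv_single]
  have e4 : invCoeff 4 = 0 := invCoeff_add_four 0
  interval_cases k <;>
    norm_num [Finset.sum_range_succ, invCoeff_zero, invCoeff_one, invCoeff_two, invCoeff_three, h0, hA0,
      hA i _ one_ne_zero, hA i _ two_ne_zero, hA i _ three_ne_zero, hA i _ four_ne_zero, d2, d3,
      d4, e4]

/-! ### Convergence of the local series. -/

theorem summable_pi_prod {r : ℕ} (u : Fin r → ℕ → ℝ) (hu0 : ∀ i k, 0 ≤ u i k)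
    (hu : ∀ i, Summable (u i)) : Summable fun ν : Fin r → ℕ => ∏ i, u i (ν i) := by
  induction r with
  | zero => exact (hasSum_unique _).summable
  | succ n ih =>
    rw [← (Fin.consEquiv fun _ => ℕ).summable_iff]
    simp only [Function.comp_def, Fin.consEquiv_apply, Fin.prod_univ_succ, Fin.cons_zero,
      Fin.cons_succ]
    have h1 := ih (fun i => u i.succ) (fun i => hu0 i.succ) fun i => hu i.succ
    have h2 : Summable fun x : ℕ × (Fin n → ℕ) => u 0 x.1 * ∏ i, u (Fin.succ i) (x.2 i) :=
      Summable.mul_of_nonneg (f := u 0) (g := fun ν : Fin n → ℕ => ∏ i, u (Fin.succ i) (ν i))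
        (hu 0) h1 (hu0 0) fun ν => Finset.prod_nonneg fun i _ => hu0 _ _
    exact h2

/-- Turns a linear bound on coefficients into a product bound, so that the multiple series factors
into one-variable series. -/
theorem sum_add_one_le_prod (ν : Fin r → ℕ) : ∑ i, (ν i : ℝ) + 1 ≤ ∏ i, ((ν i : ℝ) + 1) := by
  have h : ∀ s : Finset (Fin r), ∑ i ∈ s, (ν i : ℝ) + 1 ≤ ∏ i ∈ s, ((ν i : ℝ) + 1) := by
    intro s
    induction s using Finset.induction with
    | empty => simp
    | insert a s ha ih =>
      rw [Finset.sum_insert ha, Finset.prod_insert ha]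
      have h0 : (0 : ℝ) ≤ ∑ i ∈ s, (ν i : ℝ) := by positivity
      have ha0 : (0 : ℝ) ≤ ν a := by positivity
      nlinarith [mul_nonneg ha0 h0]
  exact h _

theorem summable_linear_mul_geometric (q : Fin r → ℝ) (hq0 : ∀ i, 0 ≤ q i) (hq1 : ∀ i, q i < 1) :
    Summable fun ν : Fin r → ℕ => (∑ i, (ν i : ℝ) + 1) * ∏ i, q i ^ ν i := by
  refine Summable.of_nonneg_of_le (fun ν => ?_) (fun ν => ?_)
    (summable_pi_prod (fun i k => ((k : ℝ) + 1) * q i ^ k) (fun i k => ?_) fun i => ?_)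
  · exact mul_nonneg (by positivity) (Finset.prod_nonneg fun i _ => pow_nonneg (hq0 i) _)
  · rw [Finset.prod_mul_distrib]
    exact mul_le_mul_of_nonneg_right (sum_add_one_le_prod ν)
      (Finset.prod_nonneg fun i _ => pow_nonneg (hq0 i) _)
  · exact mul_nonneg (by positivity) (pow_nonneg (hq0 i) _)
  · have hn : ‖q i‖ < 1 := by
      rw [Real.norm_of_nonneg (hq0 i)]
      exact hq1 i
    simp_rw [add_mul, one_mul]
    exact (by simpa using summable_pow_mul_geometric_of_norm_lt_one 1 hn : Summable _).add
      (summable_geometric_of_lt_one (hq0 i) (hq1 i))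

theorem summable_mul_geometric {A : (Fin r → ℕ) → ℝ} {C : ℝ}
    (hA : ∀ ν, |A ν| ≤ C * (∑ i, (ν i : ℝ) + 1)) {q : Fin r → ℝ} (hq0 : ∀ i, 0 ≤ q i)
    (hq1 : ∀ i, q i < 1) : Summable fun ν : Fin r → ℕ => A ν * ∏ i, q i ^ ν i := by
  refine Summable.of_norm_bounded ((summable_linear_mul_geometric q hq0 hq1).mul_left C)
    fun ν => ?_
  have h0 : 0 ≤ ∏ i, q i ^ ν i := Finset.prod_nonneg fun i _ => pow_nonneg (hq0 i) _
  rw [norm_mul, Real.norm_of_nonneg h0, ← mul_assoc]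
  exact mul_le_mul_of_nonneg_right (hA ν) h0

/-- Passing from `A` to `localInv A` multiplies the generating series by
`∏ (1 - q_i) (1 - q_i ^ 2)`. -/
theorem hasSum_localInv_mul_geometric {A : (Fin r → ℕ) → ℝ} {q : Fin r → ℝ}
    (hs : Summable fun ν : Fin r → ℕ => A ν * ∏ i, q i ^ ν i) :
    HasSum (fun ν : Fin r → ℕ => localInv A ν * ∏ i, q i ^ ν i)
      ((∏ i, (1 - q i) * (1 - q i ^ 2)) * ∑' ν : Fin r → ℕ, A ν * ∏ i, q i ^ ν i) := by
  classical
  set K : Finset (Fin r → ℕ) := Fintype.piFinset fun _ => Finset.range 4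
  set S := ∑' ν : Fin r → ℕ, A ν * ∏ i, q i ^ ν i
  -- The box depending on `ν` is replaced by the fixed finite set `K` supporting the inverse
  -- coefficients; the series is then a finite combination of shifts of the original.
  have hterm : ∀ ν, localInv A ν * ∏ i, q i ^ ν i = ∑ β ∈ K,
      if β ≤ ν then ((∏ i, invCoeff (β i)) * ∏ i, q i ^ β i) *
        (A (ν - β) * ∏ i, q i ^ (ν - β) i) else 0 := by
    intro ν
    rw [localInv, Finset.sum_mul, ← Finset.sum_filter]
    symm
    have hsub : K.filter (fun β => β ≤ ν) ⊆ expBox ν := fun β hβ =>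
      mem_expBox.2 (Finset.mem_filter.1 hβ).2
    refine Eq.trans ?_ (Finset.sum_subset hsub ?_)
    · refine Finset.sum_congr rfl fun β hβ => ?_
      have hβ' := (Finset.mem_filter.1 hβ).2
      have : ∏ i, q i ^ ν i = (∏ i, q i ^ β i) * ∏ i, q i ^ (ν - β) i := by
        rw [← Finset.prod_mul_distrib]
        refine Finset.prod_congr rfl fun i _ => ?_
        rw [← pow_add, Pi.sub_apply, Nat.add_sub_cancel' (hβ' i)]
      rw [this]
      ring
    · intro β hβ hβ'
      have hlt : ∃ i, 4 ≤ β i := by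
        by_contra! hcon
        refine hβ' (Finset.mem_filter.2 ⟨?_, mem_expBox.1 hβ⟩)
        exact Fintype.mem_piFinset.2 fun i => Finset.mem_range.2 (hcon i)
      obtain ⟨i, hi⟩ := hlt
      obtain ⟨k, hk⟩ := Nat.exists_eq_add_of_le' hi
      rw [Finset.prod_eq_zero (Finset.mem_univ i) (by rw [hk, invCoeff_add_four]), zero_mul,
        zero_mul]
  have hshift : ∀ β : Fin r → ℕ, HasSum (fun ν : Fin r → ℕ => if β ≤ ν then
      ((∏ i, invCoeff (β i)) * ∏ i, q i ^ β i) * (A (ν - β) * ∏ i, q i ^ (ν - β) i) else 0)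
      (((∏ i, invCoeff (β i)) * ∏ i, q i ^ β i) * S) := by
    intro β
    have hinj : Function.Injective fun ν : Fin r → ℕ => ν + β := add_left_injective β
    rw [← hinj.hasSum_iff]
    · simpa [Function.comp_def] using
        hs.hasSum.mul_left ((∏ i, invCoeff (β i)) * ∏ i, q i ^ β i)
    · intro ν hν
      rw [if_neg]
      exact fun h => hν ⟨ν - β, tsub_add_cancel_of_le h⟩
  have hK : ∑ β ∈ K, ((∏ i, invCoeff (β i)) * ∏ i, q i ^ β i) =
      ∏ i, (1 - q i) * (1 - q i ^ 2) := by
    simp_rw [← Finset.prod_mul_distrib]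
    rw [← Finset.prod_univ_sum (fun _ => Finset.range 4) fun i b => invCoeff b * q i ^ b]
    refine Finset.prod_congr rfl fun i _ => ?_
    simp only [Finset.sum_range_succ, Finset.sum_range_zero, invCoeff_zero, invCoeff_one,
      invCoeff_two, invCoeff_three]
    ring
  simp_rw [hterm]
  rw [← hK, Finset.sum_mul]
  exact hasSum_sum fun β _ => hshift β

/-! ### Absolute convergence of the Dirichlet series of the quotient $h$. -/

/-- The point with coordinate `θ` at `i` and all other coordinates `1`. -/
def pointAt (i : Fin r) (θ : ℝ) (j : Fin r) : ℝ := if j = i then θ else 1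

/-- A surviving exponent tuple is either supported on one axis with entry at least 5, giving
$5\theta$, or has two nonzero entries, of which at least one carries weight 1 and the other weight
at least $\theta$. -/
theorem exponent_lower_bound {B : (Fin r → ℕ) → ℝ}
    (hB : ∀ i k, 1 ≤ k → k ≤ 4 → B (Pi.single i k) = 0) (i : Fin r) {θ : ℝ} (hθ0 : 0 < θ)
    (hθ1 : θ ≤ 1) {ν : Fin r → ℕ} (hν : ν ≠ 0) (hBν : B ν ≠ 0) :
    min (5 * θ) (1 + θ) ≤ ∑ j, (ν j : ℝ) * pointAt i θ j := by
  have hs : ∀ j, θ ≤ pointAt i θ j := fun j => by unfold pointAt; split_ifs <;> linarith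
  have hs0 : ∀ j, 0 ≤ (ν j : ℝ) * pointAt i θ j := fun j =>
    mul_nonneg (Nat.cast_nonneg _) (hθ0.le.trans (hs j))
  obtain ⟨j, hj⟩ : ∃ j, ν j ≠ 0 := by
    by_contra! h
    exact hν (funext h)
  by_cases hsingle : ν = Pi.single j (ν j)
  · have h5 : 5 ≤ ν j := by
      by_contra! h
      exact hBν (hsingle ▸ hB j (ν j) (by omega) (by omega))
    refine (min_le_left _ _).trans (le_trans ?_
      (Finset.single_le_sum (fun j _ => hs0 j) (Finset.mem_univ j)))
    have : (5 : ℝ) ≤ ν j := by exact_mod_cast h5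
    exact mul_le_mul this (hs j) hθ0.le (by linarith)
  · obtain ⟨l, hlj, hl⟩ : ∃ l, l ≠ j ∧ ν l ≠ 0 := by
      by_contra! h
      refine hsingle (funext fun l => ?_)
      by_cases hl : l = j
      · subst hl
        simp
      · simp [hl, h l hl]
    have hone : ∀ l, ν l ≠ 0 → pointAt i θ l ≤ (ν l : ℝ) * pointAt i θ l := by
      intro l hl
      have : (1 : ℝ) ≤ ν l := by exact_mod_cast Nat.one_le_iff_ne_zero.2 hl
      exact le_mul_of_one_le_left (hθ0.le.trans (hs l)) this
    have hpair : (ν j : ℝ) * pointAt i θ j + (ν l : ℝ) * pointAt i θ l ≤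
        ∑ j, (ν j : ℝ) * pointAt i θ j := by
      rw [← Finset.sum_pair hlj.symm (f := fun j => (ν j : ℝ) * pointAt i θ j)]
      exact Finset.sum_le_sum_of_subset_of_nonneg (Finset.subset_univ _) fun j _ _ => hs0 j
    refine (min_le_right _ _).trans (le_trans ?_ hpair)
    have h1 := hone j hj
    have h2 := hone l hl
    have h3 : 1 + θ ≤ pointAt i θ j + pointAt i θ l := by
      by_cases hji : j = i
      · have hli : l ≠ i := fun h => hlj (h.trans hji.symm)
        simp [pointAt, hji, hli, add_comm]
      · have := hs l
        have h1 : pointAt i θ j = 1 := by simp [pointAt, hji]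
        linarith
    linarith

theorem rpow_neg_sum_eq_prod {x : ℝ} (hx : 0 < x) (s : Fin r → ℝ) (ν : Fin r → ℕ) :
    x ^ (-∑ j, (ν j : ℝ) * s j) = ∏ j, (x ^ (-s j)) ^ ν j := by
  rw [← Finset.sum_neg_distrib, Real.rpow_sum_of_pos hx]
  refine Finset.prod_congr rfl fun j _ => ?_
  rw [← Real.rpow_natCast, ← Real.rpow_mul hx.le]
  congr 1
  ring

/-- The exponent of $p$ is at least $1+\eta>1$ and also at least $\theta\sum_j\nu_j$. A convex
combination of the two bounds gives convergence over $p$ and over $\nu$ simultaneously. -/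
theorem summable_primes_local {B : (Fin r → ℕ) → ℝ} {C : ℝ}
    (hBle : ∀ ν, |B ν| ≤ C * (∑ i, (ν i : ℝ) + 1))
    (hB : ∀ i k, 1 ≤ k → k ≤ 4 → B (Pi.single i k) = 0) (i : Fin r) {θ : ℝ} (hθ : 1 / 5 < θ)
    (hθ1 : θ ≤ 1) :
    Summable fun x : Nat.Primes × {ν : Fin r → ℕ // ν ≠ 0} =>
      |B x.2 * ((x.1 : ℕ) : ℝ) ^ (-∑ j, (x.2.1 j : ℝ) * pointAt i θ j)| := by
  have hθ0 : 0 < θ := by linarith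
  obtain ⟨η, hη0, hη⟩ : ∃ η : ℝ, 0 < η ∧ 1 + η = min (5 * θ) (1 + θ) :=
    ⟨min (5 * θ) (1 + θ) - 1, by
      have : 1 < min (5 * θ) (1 + θ) := lt_min (by linarith) (by linarith)
      linarith, by ring⟩
  -- The weight is chosen so that $(1-l)(1+\eta)=1+\eta/2$: half of the surplus $\eta$ remains for
  -- the sum over primes.
  set l : ℝ := η / (2 * (1 + η))
  have hl0 : 0 < l := by positivity
  have hl1 : l < 1 := by
    rw [div_lt_one (by positivity)]
    linarith
  have hleq : (1 - l) * (1 + η) = 1 + η / 2 := by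
    simp only [l]
    field_simp
    ring
  have hq1 : (2 : ℝ) ^ (-(l * θ)) < 1 :=
    Real.rpow_lt_one_of_one_lt_of_neg (by norm_num) (by nlinarith [mul_pos hl0 hθ0])
  have hC : ∀ ν, |B ν * ∏ j, ((2 : ℝ) ^ (-(l * θ))) ^ ν j| =
      |B ν| * ∏ j, ((2 : ℝ) ^ (-(l * θ))) ^ ν j := by
    intro ν
    have h : 0 ≤ ∏ j, ((2 : ℝ) ^ (-(l * θ))) ^ ν j := Finset.prod_nonneg fun i _ => by positivity
    rw [abs_mul, abs_of_nonneg h]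
  have hsum2 : Summable fun ν : {ν : Fin r → ℕ // ν ≠ 0} =>
      |B ν| * ∏ j, ((2 : ℝ) ^ (-(l * θ))) ^ ν.1 j := by
    have h := (summable_mul_geometric hBle (q := fun _ : Fin r => (2 : ℝ) ^ (-(l * θ)))
      (fun _ => by positivity) fun _ => hq1).abs
    simp_rw [hC] at h
    exact h.subtype {ν | ν ≠ 0}
  have hsum1 : Summable fun p : Nat.Primes => ((p : ℕ) : ℝ) ^ (-(1 + η / 2)) :=
    Nat.Primes.summable_rpow.2 (by linarith)
  refine Summable.of_nonneg_of_le (fun _ => abs_nonneg _) (fun x => ?_)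
    (hsum1.mul_of_nonneg hsum2 (fun p => by positivity) fun ν => by positivity)
  obtain ⟨p, ν, hν⟩ := x
  have hp2 : (2 : ℝ) ≤ ((p : ℕ) : ℝ) := by exact_mod_cast p.2.two_le
  have hp0 : (0 : ℝ) < ((p : ℕ) : ℝ) := by linarith
  by_cases hBν : B ν = 0
  · simp [hBν]
  · rw [abs_mul, abs_of_nonneg (Real.rpow_nonneg hp0.le _), mul_left_comm]
    refine mul_le_mul_of_nonneg_left ?_ (abs_nonneg _)
    have hlow := exponent_lower_bound hB i hθ0 hθ1 hν hBν
    rw [← hη] at hlow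
    have hlow2 : θ * ∑ j, (ν j : ℝ) ≤ ∑ j, (ν j : ℝ) * pointAt i θ j := by
      rw [Finset.mul_sum]
      refine Finset.sum_le_sum fun j _ => ?_
      rw [mul_comm]
      refine mul_le_mul_of_nonneg_left ?_ (Nat.cast_nonneg _)
      unfold pointAt
      split_ifs <;> linarith
    have hcomb : (1 + η / 2) + l * θ * ∑ j, (ν j : ℝ) ≤ ∑ j, (ν j : ℝ) * pointAt i θ j := by
      rw [← hleq]
      nlinarith
    calc ((p : ℕ) : ℝ) ^ (-∑ j, (ν j : ℝ) * pointAt i θ j)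
        ≤ ((p : ℕ) : ℝ) ^ (-(1 + η / 2) + -∑ j, (ν j : ℝ) * (l * θ)) := by
          refine Real.rpow_le_rpow_of_exponent_le (by linarith) ?_
          rw [← Finset.sum_mul]
          linarith
      _ = ((p : ℕ) : ℝ) ^ (-(1 + η / 2)) * ((p : ℕ) : ℝ) ^ (-∑ j, (ν j : ℝ) * (l * θ)) :=
          Real.rpow_add hp0 _ _
      -- Using $p\ge2$ in the second factor only decouples the sum over $\nu$ from the sum over $p$.
      _ ≤ ((p : ℕ) : ℝ) ^ (-(1 + η / 2)) * (2 : ℝ) ^ (-∑ j, (ν j : ℝ) * (l * θ)) := by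
          refine mul_le_mul_of_nonneg_left ?_ (by positivity)
          refine Real.rpow_le_rpow_of_nonpos (by norm_num) hp2 ?_
          rw [neg_nonpos]
          positivity
      _ = ((p : ℕ) : ℝ) ^ (-(1 + η / 2)) * ∏ j, ((2 : ℝ) ^ (-(l * θ))) ^ ν j := by
          rw [rpow_neg_sum_eq_prod (by norm_num) (fun _ => l * θ)]

/-- The weight `∏ d_i ^ (-s_i)`. -/
def tupleWeight (s : Fin r → ℝ) (d : Fin r → ℕ) : ℝ := ∏ i, (d i : ℝ) ^ (-s i)

theorem tupleWeight_pow {p : ℕ} (hp : p.Prime) (s : Fin r → ℝ) (ν : Fin r → ℕ) :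
    tupleWeight s (fun i => p ^ ν i) = (p : ℝ) ^ (-∑ j, (ν j : ℝ) * s j) := by
  have hp0 : (0 : ℝ) < p := by exact_mod_cast hp.pos
  rw [rpow_neg_sum_eq_prod hp0]
  refine Finset.prod_congr rfl fun j _ => ?_
  rw [Nat.cast_pow, ← Real.rpow_natCast, ← Real.rpow_natCast, ← Real.rpow_mul hp0.le,
    ← Real.rpow_mul hp0.le, mul_comm]

theorem IsTupleMult.mul_tupleWeight {f : (Fin r → ℕ) → ℝ} (hf : IsTupleMult f) (s : Fin r → ℝ) :
    IsTupleMult fun d => f d * tupleWeight s d where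
  map_one := by simp [hf.map_one, tupleWeight]
  map_zero d hd := by simp [hf.map_zero d hd]
  map_mul p hp ν m hm := by
    have : tupleWeight s (fun i => p ^ ν i * m i) =
        tupleWeight s (fun i => p ^ ν i) * tupleWeight s m := by
      simp only [tupleWeight, ← Finset.prod_mul_distrib]
      refine Finset.prod_congr rfl fun i _ => ?_
      rw [Nat.cast_mul, Real.mul_rpow (Nat.cast_nonneg _) (Nat.cast_nonneg _)]
    rw [hf.map_mul p hp ν m hm, this]
    ring

theorem summable_ofLocal_weight {B : (Fin r → ℕ) → ℝ} {C : ℝ} (hB0 : B 0 = 1)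
    (hBle : ∀ ν, |B ν| ≤ C * (∑ i, (ν i : ℝ) + 1))
    (hB : ∀ i k, 1 ≤ k → k ≤ 4 → B (Pi.single i k) = 0) (i : Fin r) {θ : ℝ} (hθ : 1 / 5 < θ)
    (hθ1 : θ ≤ 1) : Summable fun d => |ofLocal B d * tupleWeight (pointAt i θ) d| := by
  refine ((isTupleMult_ofLocal hB0).mul_tupleWeight _).summable_abs ?_
  refine (summable_primes_local hBle hB i hθ hθ1).congr fun x => ?_
  rw [ofLocal_pow hB0 x.1.2, tupleWeight_pow x.1.2]

theorem hasProd_ofLocal_weight {B : (Fin r → ℕ) → ℝ} {C : ℝ} (hB0 : B 0 = 1)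
    (hBle : ∀ ν, |B ν| ≤ C * (∑ i, (ν i : ℝ) + 1))
    (hB : ∀ i k, 1 ≤ k → k ≤ 4 → B (Pi.single i k) = 0) (i : Fin r) {θ : ℝ} (hθ : 1 / 5 < θ)
    (hθ1 : θ ≤ 1) :
    HasProd (fun p : Nat.Primes => ∑' ν, B ν * ((p : ℕ) : ℝ) ^ (-∑ j, (ν j : ℝ) * pointAt i θ j))
      (∑' d, ofLocal B d * tupleWeight (pointAt i θ) d) := by
  have h := ((isTupleMult_ofLocal hB0).mul_tupleWeight (pointAt i θ)).hasProd
    (summable_ofLocal_weight hB0 hBle hB i hθ hθ1)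
  convert h using 2 with p
  refine tsum_congr fun ν => ?_
  rw [ofLocal_pow hB0 p.2, tupleWeight_pow p.2]

/-! ### The summatory function of $\tau_{1,2}$ and the exponent $\theta_2$. -/

/-- The summatory function of `τ_{1,2}`. -/
def tauSum (y : ℝ) : ℝ := ∑ n ∈ Finset.Icc 1 ⌊y⌋₊, (tauOne 2 n : ℝ)

theorem tauSum_of_lt_one {y : ℝ} (hy : y < 1) : tauSum y = 0 := by
  rw [tauSum, Nat.floor_eq_zero.2 hy]
  simp

theorem zetaReal_two_eq : zetaReal 2 = Real.pi ^ 2 / 6 := by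
  have h := ofReal_zetaReal 2
  rw [Complex.ofReal_ofNat, riemannZeta_two] at h
  exact_mod_cast h

theorem hasSum_zetaReal_two : HasSum (fun n : ℕ => ((n : ℝ) ^ 2)⁻¹) (zetaReal 2) := by
  rw [zetaReal_two_eq]
  simpa using hasSum_zeta_two

theorem zetaReal_two_pos : 0 < zetaReal 2 := by
  rw [zetaReal_two_eq]
  positivity

theorem sum_inv_sq_le_zetaReal_two (B : ℕ) :
    ∑ b ∈ Finset.Icc 1 B, ((b : ℝ) ^ 2)⁻¹ ≤ zetaReal 2 :=
  sum_le_hasSum _ (fun _ _ => by positivity) hasSum_zetaReal_two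

theorem zetaReal_two_le (B : ℕ) :
    zetaReal 2 ≤ ∑ b ∈ Finset.Icc 1 B, ((b : ℝ) ^ 2)⁻¹ + 2 / (B + 1) := by
  refine le_of_tendsto hasSum_zetaReal_two.tendsto_sum_nat ?_
  filter_upwards [eventually_gt_atTop B] with M hM
  have hsplit : Finset.range M = insert 0 (Finset.Icc 1 B ∪ Finset.Ioo B M) := by
    ext b
    simp only [Finset.mem_range, Finset.mem_insert, Finset.mem_union, Finset.mem_Icc,
      Finset.mem_Ioo]
    omega
  have hdisj : Disjoint (Finset.Icc 1 B) (Finset.Ioo B M) := by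
    rw [Finset.disjoint_left]
    intro b hb hb'
    have := Finset.mem_Icc.1 hb
    have := Finset.mem_Ioo.1 hb'
    omega
  rw [hsplit, Finset.sum_insert (by simp), Finset.sum_union hdisj]
  have := sum_Ioo_inv_sq_le (α := ℝ) B M
  simp only [Nat.cast_zero, ne_eq, OfNat.ofNat_ne_zero, not_false_eq_true, zero_pow, inv_zero,
    zero_add]
  linarith

theorem tauSum_eq_sum_div (y : ℝ) :
    tauSum y = ∑ b ∈ Finset.Icc 1 (Nat.sqrt ⌊y⌋₊), ((⌊y⌋₊ / b ^ 2 : ℕ) : ℝ) := by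
  set N := ⌊y⌋₊
  have h1 : ∀ n ∈ Finset.Icc 1 N, (tauOne 2 n : ℝ) =
      ∑ b ∈ Finset.Icc 1 (Nat.sqrt N), if b ^ 2 ∣ n then (1 : ℝ) else 0 := by
    intro n hn
    obtain ⟨hn1, hnN⟩ := Finset.mem_Icc.1 hn
    rw [tauOne_two_eq_sum, Finset.sum_boole, Finset.sum_boole]
    congr 2
    ext b
    simp only [Finset.mem_filter, Nat.mem_divisors, Finset.mem_Icc]
    constructor
    · rintro ⟨⟨hb, -⟩, hb2⟩
      refine ⟨⟨Nat.pos_of_dvd_of_pos hb hn1, ?_⟩, hb2⟩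
      rw [Nat.le_sqrt']
      exact (Nat.le_of_dvd hn1 hb2).trans hnN
    · rintro ⟨-, hb2⟩
      exact ⟨⟨(dvd_pow_self b two_ne_zero).trans hb2, by omega⟩, hb2⟩
  rw [tauSum, Finset.sum_congr rfl h1, Finset.sum_comm]
  refine Finset.sum_congr rfl fun b _ => ?_
  rw [Finset.sum_boole]
  have := Nat.Ioc_filter_dvd_card_eq_div N (b ^ 2)
  rw [← this]
  rfl

/-- In $T(y)=\sum_{b\le\sqrt y}\lfloor y/b^2\rfloor$ each floor costs at most 1, and completing
$\sum b^{-2}$ to $\zeta(2)$ costs at most $2\sqrt y$. For $y<1$ one has $T(y)=0$ and $y\le\sqrt y$,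
so the bound holds for every $y>0$. -/
theorem abs_tauSum_sub_le : ∃ C : ℝ, 0 ≤ C ∧ ∀ y : ℝ, 0 < y →
    |tauSum y - zetaReal 2 * y| ≤ C * y ^ (1 / 2 : ℝ) := by
  have hz := zetaReal_two_pos
  refine ⟨3 + zetaReal 2, by linarith, fun y hy => ?_⟩
  rw [← Real.sqrt_eq_rpow]
  have hsq : √y * √y = y := Real.mul_self_sqrt hy.le
  have hs0 : 0 < √y := Real.sqrt_pos.2 hy
  rcases lt_or_ge y 1 with h1 | h1
  · rw [tauSum_of_lt_one h1, zero_sub, abs_neg, abs_of_pos (by positivity)]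
    have : √y ≤ 1 := Real.sqrt_le_one.2 h1.le
    have : y ≤ √y := by nlinarith
    nlinarith
  · set N := ⌊y⌋₊
    set B := Nat.sqrt N
    have hN : (N : ℝ) ≤ y := Nat.floor_le hy.le
    have hB1 : (B : ℝ) ≤ √y := by
      apply Real.le_sqrt_of_sq_le
      have : B ^ 2 ≤ N := Nat.sqrt_le' N
      have : ((B ^ 2 : ℕ) : ℝ) ≤ N := by exact_mod_cast this
      push_cast at this
      linarith
    have hB2 : √y ≤ B + 1 := by
      rw [Real.sqrt_le_left (by positivity)]
      have h2 : N + 1 ≤ (B + 1) ^ 2 := Nat.lt_succ_sqrt' N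
      have h3 : ((N + 1 : ℕ) : ℝ) ≤ ((B + 1) ^ 2 : ℕ) := by exact_mod_cast h2
      have h4 : y < N + 1 := Nat.lt_floor_add_one y
      push_cast at h3
      linarith
    have hmain : |tauSum y - y * ∑ b ∈ Finset.Icc 1 B, ((b : ℝ) ^ 2)⁻¹| ≤ B := by
      rw [tauSum_eq_sum_div, Finset.mul_sum, ← Finset.sum_sub_distrib]
      refine (Finset.abs_sum_le_sum_abs _ _).trans ?_
      have : ∀ b ∈ Finset.Icc 1 B,
          |((⌊y⌋₊ / b ^ 2 : ℕ) : ℝ) - y * ((b : ℝ) ^ 2)⁻¹| ≤ 1 := by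
        intro b _
        rw [← Nat.floor_div_natCast, ← div_eq_mul_inv, Nat.cast_pow, abs_le]
        have h2 := Nat.floor_le (a := y / (b : ℝ) ^ 2) (by positivity)
        have h3 := Nat.lt_floor_add_one (y / (b : ℝ) ^ 2)
        constructor <;> linarith
      refine (Finset.sum_le_sum this).trans ?_
      simp
    have hlow := sum_inv_sq_le_zetaReal_two B
    have hup := zetaReal_two_le B
    have htail : y * (2 / (B + 1)) ≤ 2 * √y := by
      rw [mul_div_assoc', div_le_iff₀ (by positivity)]
      nlinarith
    have htail2 : |y * ∑ b ∈ Finset.Icc 1 B, ((b : ℝ) ^ 2)⁻¹ - zetaReal 2 * y| ≤ 2 * √y := by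
      rw [abs_le]
      constructor <;> nlinarith
    calc |tauSum y - zetaReal 2 * y|
        ≤ |tauSum y - y * ∑ b ∈ Finset.Icc 1 B, ((b : ℝ) ^ 2)⁻¹| +
          |y * ∑ b ∈ Finset.Icc 1 B, ((b : ℝ) ^ 2)⁻¹ - zetaReal 2 * y| := abs_sub_le _ _ _
      _ ≤ (3 + zetaReal 2) * √y := by nlinarith

theorem abs_tauSum_sub_sub_le : ∃ C : ℝ, 0 ≤ C ∧ ∀ y : ℝ, 0 < y →
    |tauSum y - (zetaReal 2 * y + zetaReal (1 / 2) * y ^ (1 / 2 : ℝ))| ≤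
      C * y ^ (1 / 2 : ℝ) := by
  obtain ⟨C, hC, h⟩ := abs_tauSum_sub_le
  refine ⟨C + |zetaReal (1 / 2)|, by positivity, fun y hy => ?_⟩
  have h0 : (0 : ℝ) ≤ y ^ (1 / 2 : ℝ) := by positivity
  calc _ = |(tauSum y - zetaReal 2 * y) - zetaReal (1 / 2) * y ^ (1 / 2 : ℝ)| := by ring_nf
    _ ≤ |tauSum y - zetaReal 2 * y| + |zetaReal (1 / 2) * y ^ (1 / 2 : ℝ)| := abs_sub _ _
    _ ≤ _ := by
      rw [abs_mul, abs_of_nonneg h0, add_mul]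
      exact add_le_add (h y hy) le_rfl

theorem isErrorExponent_half : IsErrorExponent (1 / 2) := by
  obtain ⟨C, hC, h⟩ := abs_tauSum_sub_sub_le
  intro ε hε
  refine IsBigO.of_bound C ?_
  filter_upwards [eventually_ge_atTop 1] with x hx
  rw [Real.norm_eq_abs, Real.norm_of_nonneg (by positivity)]
  refine (h x (by linarith)).trans (mul_le_mul_of_nonneg_left ?_ hC)
  exact Real.rpow_le_rpow_of_exponent_le hx (by linarith)

theorem tendsto_sqrt_add_half_sub_sqrt :
    Tendsto (fun n : ℕ => √((n : ℝ) + 1 / 2) - √(n : ℝ)) atTop (𝓝 0) := by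
  have hlim : Tendsto (fun n : ℕ => (√(n : ℝ))⁻¹) atTop (𝓝 0) :=
    (Real.tendsto_sqrt_atTop.comp tendsto_natCast_atTop_atTop).inv_tendsto_atTop
  refine squeeze_zero' (Eventually.of_forall fun n => ?_) ?_ hlim
  · exact sub_nonneg.2 (Real.sqrt_le_sqrt (by linarith))
  · filter_upwards [eventually_gt_atTop 0] with n hn
    have hn0 : (0 : ℝ) < n := by exact_mod_cast hn
    have hs : 0 < √(n : ℝ) := Real.sqrt_pos.2 hn0
    rw [sub_le_iff_le_add, Real.sqrt_le_left (by positivity)]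
    have h1 : √(n : ℝ) ^ 2 = n := Real.sq_sqrt hn0.le
    have h2 : (√(n : ℝ))⁻¹ * √(n : ℝ) = 1 := inv_mul_cancel₀ hs.ne'
    nlinarith [sq_nonneg (√(n : ℝ))⁻¹]

/-- A negative exponent would force the error to tend to 0. But $T$ takes the same value at $n$ and
$n+1/2$, while the main term changes by $\zeta(2)/2+o(1)$. -/
theorem IsErrorExponent.nonneg {θ : ℝ} (h : IsErrorExponent θ) : 0 ≤ θ := by
  by_contra! hθ
  set E : ℝ → ℝ := fun x => tauSum x - (zetaReal 2 * x + zetaReal (1 / 2) * x ^ (1 / 2 : ℝ))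
  have hE : Tendsto E atTop (𝓝 0) := by
    refine (h (-θ / 2) (by linarith)).trans_tendsto ?_
    have := tendsto_rpow_neg_atTop (y := -(θ + -θ / 2)) (by linarith)
    simpa using this
  have h1 : Tendsto (fun n : ℕ => E n) atTop (𝓝 0) := hE.comp tendsto_natCast_atTop_atTop
  have h2 : Tendsto (fun n : ℕ => E ((n : ℝ) + 1 / 2)) atTop (𝓝 0) :=
    hE.comp (tendsto_atTop_add_const_right _ _ tendsto_natCast_atTop_atTop)
  have hdiff : ∀ n : ℕ, E n - E ((n : ℝ) + 1 / 2) =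
      zetaReal 2 / 2 + zetaReal (1 / 2) * (√((n : ℝ) + 1 / 2) - √(n : ℝ)) := by
    intro n
    have hfl : ⌊(n : ℝ) + 1 / 2⌋₊ = n := by
      rw [Nat.floor_eq_iff (by positivity)]
      constructor <;> linarith
    have : tauSum ((n : ℝ) + 1 / 2) = tauSum n := by rw [tauSum, tauSum, hfl, Nat.floor_natCast]
    simp only [E, this, ← Real.sqrt_eq_rpow]
    ring
  have h3 : Tendsto (fun n : ℕ => E n - E ((n : ℝ) + 1 / 2)) atTop (𝓝 (zetaReal 2 / 2)) := by
    simp_rw [hdiff]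
    simpa using (tendsto_sqrt_add_half_sub_sqrt.const_mul (zetaReal (1 / 2))).const_add
      (zetaReal 2 / 2)
  have h4 := tendsto_nhds_unique h3 (h1.sub h2)
  have := zetaReal_two_pos
  linarith

/-- The set contains $1/2$ and is bounded below by 0; the infimum is attained because the definition
already allows an arbitrary $\varepsilon$. -/
theorem isLeast_thetaTwo : IsLeast {θ : ℝ | IsErrorExponent θ} thetaTwo := by
  have hbdd : BddBelow {θ : ℝ | IsErrorExponent θ} := ⟨0, fun θ h => IsErrorExponent.nonneg h⟩
  refine ⟨fun ε hε => ?_, fun θ hθ => csInf_le hbdd hθ⟩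
  obtain ⟨θ, hθ, hlt⟩ := exists_lt_of_csInf_lt ⟨_, isErrorExponent_half⟩
    (show sInf {θ : ℝ | IsErrorExponent θ} < thetaTwo + ε from lt_add_of_pos_right _ hε)
  have := hθ (thetaTwo + ε - θ) (by linarith)
  rwa [add_sub_cancel] at this

/-- Absorbs $\varepsilon$ into one exponent and makes the bound uniform over all $y>0$, including
small $y=x/d_i$. Beyond some $Z$ the definition of $\theta_2$ applies; below $Z$ the elementary
$y^{1/2}$ bound suffices, since $y^{1/2-\theta}\le Z^{1/2-\theta}$. If
$\theta_2^*+\varepsilon\ge1/2$, the elementary bound alone is enough. -/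
theorem exists_tauSum_error_bound {ε : ℝ} (hε : 0 < ε) : ∃ θ C : ℝ, 1 / 5 < θ ∧ θ ≤ 1 / 2 ∧
    θ ≤ max thetaTwo (1 / 5) + ε ∧ 0 ≤ C ∧ ∀ y : ℝ, 0 < y →
      |tauSum y - (zetaReal 2 * y + zetaReal (1 / 2) * y ^ (1 / 2 : ℝ))| ≤ C * y ^ θ := by
  obtain ⟨C₀, hC₀, h₀⟩ := abs_tauSum_sub_sub_le
  rcases lt_or_ge (max thetaTwo (1 / 5) + ε) (1 / 2) with hlt | hge
  · set θ := max thetaTwo (1 / 5) + ε with hθ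
    have h1 : thetaTwo ≤ max thetaTwo (1 / 5) := le_max_left _ _
    have h2 : 1 / 5 ≤ max thetaTwo (1 / 5) := le_max_right _ _
    have hO := isLeast_thetaTwo.1 (θ - thetaTwo) (by linarith)
    rw [add_sub_cancel] at hO
    obtain ⟨C₁, hC₁, hb⟩ := hO.exists_nonneg
    obtain ⟨Y, hY⟩ := eventually_atTop.1 hb.bound
    set Z := max Y 1
    have hZ : 1 ≤ Z := le_max_right _ _
    refine ⟨θ, max C₁ (C₀ * Z ^ (1 / 2 - θ)), by linarith, hlt.le, le_rfl,
      hC₁.trans (le_max_left _ _), fun y hy => ?_⟩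
    rcases le_or_gt Z y with hZy | hZy
    · have := hY y ((le_max_left _ _).trans hZy)
      rw [Real.norm_eq_abs, Real.norm_of_nonneg (by positivity)] at this
      exact this.trans (mul_le_mul_of_nonneg_right (le_max_left _ _) (by positivity))
    · calc _ ≤ C₀ * y ^ (1 / 2 : ℝ) := h₀ y hy
        _ = C₀ * y ^ (1 / 2 - θ) * y ^ θ := by
          rw [mul_assoc, ← Real.rpow_add hy]
          congr 2
          ring
        _ ≤ C₀ * Z ^ (1 / 2 - θ) * y ^ θ := by
          gcongr
        _ ≤ _ := mul_le_mul_of_nonneg_right (le_max_right _ _) (by positivity)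
  · exact ⟨1 / 2, C₀, by norm_num, le_rfl, hge, hC₀, h₀⟩

/-! ### Products of summatory functions and summation against $h$. -/

theorem exists_abs_prod_one_add_sub_one_le (r : ℕ) {D : ℝ} (hD : 0 ≤ D) :
    ∃ K : ℝ, 0 ≤ K ∧ ∀ x : Fin r → ℝ, (∀ i, |x i| ≤ D) →
      |∏ i, (1 + x i) - 1| ≤ K * ∑ i, |x i| := by
  induction r with
  | zero => exact ⟨0, le_rfl, fun x _ => by simp⟩
  | succ n ih =>
    obtain ⟨K, hK, h⟩ := ih
    refine ⟨1 + (1 + D) * K, by positivity, fun x hx => ?_⟩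
    rw [Fin.prod_univ_succ, Fin.sum_univ_succ]
    have h1 := h (fun i => x i.succ) fun i => hx i.succ
    set P := ∏ i : Fin n, (1 + x i.succ)
    set S := ∑ i : Fin n, |x i.succ|
    have hS : 0 ≤ S := Finset.sum_nonneg fun _ _ => abs_nonneg _
    have h2 : |1 + x 0| ≤ 1 + D := (abs_add_le _ _).trans (by simpa using hx 0)
    calc |(1 + x 0) * P - 1| = |(1 + x 0) * (P - 1) + x 0| := by ring_nf
      _ ≤ |1 + x 0| * |P - 1| + |x 0| := (abs_add_le _ _).trans (by rw [abs_mul])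
      _ ≤ (1 + D) * (K * S) + |x 0| := by gcongr
      _ ≤ (1 + (1 + D) * K) * (|x 0| + S) := by
        have : 0 ≤ (1 + D) * K * |x 0| := by positivity
        nlinarith

/-- Induction on the number of factors; the mixed terms $|x_ix_0|$ are bounded by $x_i^2+x_0^2$, so
the error involves each variable separately. -/
theorem exists_abs_prod_one_add_sub_le (r : ℕ) {D : ℝ} (hD : 0 ≤ D) :
    ∃ K : ℝ, 0 ≤ K ∧ ∀ x : Fin r → ℝ, (∀ i, |x i| ≤ D) →
      |∏ i, (1 + x i) - (1 + ∑ i, x i)| ≤ K * ∑ i, x i ^ 2 := by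
  induction r with
  | zero => exact ⟨0, le_rfl, fun x _ => by simp⟩
  | succ n ih =>
    obtain ⟨K, hK, h⟩ := ih
    obtain ⟨L, hL, h'⟩ := exists_abs_prod_one_add_sub_one_le n hD
    refine ⟨K + L * (n + 1), by positivity, fun x hx => ?_⟩
    rw [Fin.prod_univ_succ, Fin.sum_univ_succ, Fin.sum_univ_succ]
    have h1 := h (fun i => x i.succ) fun i => hx i.succ
    have h2 := h' (fun i => x i.succ) fun i => hx i.succ
    set P := ∏ i : Fin n, (1 + x i.succ)
    set Q := ∑ i : Fin n, x i.succ
    set S := ∑ i : Fin n, |x i.succ|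
    set V := ∑ i : Fin n, x i.succ ^ 2
    have hV : 0 ≤ V := Finset.sum_nonneg fun _ _ => sq_nonneg _
    have hSV : S * |x 0| ≤ V + n * x 0 ^ 2 := by
      rw [Finset.sum_mul]
      calc ∑ i : Fin n, |x i.succ| * |x 0| ≤ ∑ i : Fin n, (x i.succ ^ 2 + x 0 ^ 2) := by
            refine Finset.sum_le_sum fun i _ => ?_
            nlinarith [sq_nonneg (|x i.succ| - |x 0|), sq_abs (x i.succ), sq_abs (x 0)]
        _ = V + n * x 0 ^ 2 := by simp [Finset.sum_add_distrib, V]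
    calc |(1 + x 0) * P - (1 + (x 0 + Q))| = |(P - (1 + Q)) + (P - 1) * x 0| := by ring_nf
      _ ≤ |P - (1 + Q)| + |P - 1| * |x 0| := (abs_add_le _ _).trans (by rw [abs_mul])
      _ ≤ K * V + L * S * |x 0| := by gcongr
      _ ≤ K * V + L * (V + n * x 0 ^ 2) := by
        rw [mul_assoc]
        gcongr
      _ ≤ (K + L * (n + 1)) * (x 0 ^ 2 + V) := by
        have h3 : 0 ≤ x 0 ^ 2 := sq_nonneg _
        have h4 : 0 ≤ K * x 0 ^ 2 := by positivity
        have h5 : 0 ≤ L * x 0 ^ 2 := by positivity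
        have h6 : 0 ≤ L * n * V := by positivity
        nlinarith

/-- The expansion of `∏ T(y_i)` to second order, where `T` is the summatory function
of `τ_{1,2}`. -/
theorem exists_prod_tauSum_bound (r : ℕ) {θ C : ℝ} (hθ0 : 0 ≤ θ) (hθ : θ ≤ 1 / 2) (hC : 0 ≤ C)
    (hE : ∀ y : ℝ, 0 < y →
      |tauSum y - (zetaReal 2 * y + zetaReal (1 / 2) * y ^ (1 / 2 : ℝ))| ≤ C * y ^ θ) :
    ∃ K : ℝ, 0 ≤ K ∧ ∀ y : Fin r → ℝ, (∀ i, 0 < y i) →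
      |∏ i, tauSum (y i) - zetaReal 2 ^ r * (∏ i, y i) *
        (1 + ∑ i, zetaReal (1 / 2) / zetaReal 2 * y i ^ (-(1 / 2) : ℝ))| ≤
        K * ((∏ i, y i) * ∑ i, y i ^ (θ - 1)) := by
  have ha := zetaReal_two_pos
  set a := zetaReal 2
  set b := zetaReal (1 / 2)
  obtain ⟨C₂, hC₂, hT⟩ := abs_tauSum_sub_le
  -- `D` bounds the relative error $T(y)/(\zeta(2)y)-1$: the entry 1 serves $y<1$, where $T(y)=0$
  -- and this error is $-1$, and `C₂ / a` serves $y\ge1$. Its square is $O(y^{\theta-1})$ in both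
  -- ranges: $y^{\theta-1}\ge1$ in the first, $y^{-1}\le y^{\theta-1}$ in the second.
  set D : ℝ := max 1 (C₂ / a)
  have hD : 0 ≤ D := zero_le_one.trans (le_max_left _ _)
  obtain ⟨K, hK, hprod⟩ := exists_abs_prod_one_add_sub_le r hD
  have hsmall : ∀ y : ℝ, 0 < y → |tauSum y / (a * y) - 1| ≤ D ∧
      (tauSum y / (a * y) - 1) ^ 2 ≤ D ^ 2 * y ^ (θ - 1) := by
    intro y hy
    rcases lt_or_ge y 1 with h1 | h1
    · rw [tauSum_of_lt_one h1]
      have h2 : 1 ≤ D := le_max_left _ _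
      have h3 : 1 ≤ y ^ (θ - 1) := Real.one_le_rpow_of_pos_of_le_one_of_nonpos hy h1.le (by linarith)
      refine ⟨by simpa using h2, ?_⟩
      rw [zero_div, zero_sub, neg_one_sq]
      exact one_le_mul_of_one_le_of_one_le (one_le_pow₀ h2) h3
    · have h2 : |tauSum y / (a * y) - 1| ≤ D * y ^ (-(1 / 2) : ℝ) := by
        have h3 : tauSum y / (a * y) - 1 = (tauSum y - a * y) / (a * y) := by
          field_simp
        have h4 : y ^ (1 / 2 : ℝ) = y ^ (-(1 / 2) : ℝ) * y := by
          rw [← Real.rpow_add_one hy.ne']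
          norm_num
        rw [h3, abs_div, abs_of_pos (mul_pos ha hy), div_le_iff₀ (mul_pos ha hy)]
        refine (hT y hy).trans ?_
        have h5 : C₂ ≤ D * a := (div_le_iff₀ ha).1 (le_max_right _ _)
        calc C₂ * y ^ (1 / 2 : ℝ) ≤ D * a * y ^ (1 / 2 : ℝ) := by gcongr
          _ = D * y ^ (-(1 / 2) : ℝ) * (a * y) := by
            rw [h4]
            ring
      have h6 : y ^ (-(1 / 2) : ℝ) ≤ 1 := Real.rpow_le_one_of_one_le_of_nonpos h1 (by norm_num)
      refine ⟨h2.trans (mul_le_of_le_one_right hD h6), ?_⟩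
      rw [← sq_abs]
      calc |tauSum y / (a * y) - 1| ^ 2 ≤ (D * y ^ (-(1 / 2) : ℝ)) ^ 2 := by gcongr
        _ = D ^ 2 * y ^ (-1 : ℝ) := by
          rw [mul_pow, ← Real.rpow_natCast (y ^ (-(1 / 2) : ℝ)), ← Real.rpow_mul hy.le]
          norm_num
        _ ≤ D ^ 2 * y ^ (θ - 1) := by
          refine mul_le_mul_of_nonneg_left ?_ (sq_nonneg _)
          exact Real.rpow_le_rpow_of_exponent_le h1 (by linarith)
  have hlin : ∀ y : ℝ, 0 < y →
      |tauSum y / (a * y) - 1 - b / a * y ^ (-(1 / 2) : ℝ)| ≤ C / a * y ^ (θ - 1) := by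
    intro y hy
    have h4 : y ^ (1 / 2 : ℝ) = y ^ (-(1 / 2) : ℝ) * y := by
      rw [← Real.rpow_add_one hy.ne']
      norm_num
    have h5 : y ^ θ = y ^ (θ - 1) * y := by
      rw [← Real.rpow_add_one hy.ne']
      norm_num
    have h3 : tauSum y / (a * y) - 1 - b / a * y ^ (-(1 / 2) : ℝ) =
        (tauSum y - (a * y + b * y ^ (1 / 2 : ℝ))) / (a * y) := by
      rw [h4]
      field_simp
      ring
    rw [h3, abs_div, abs_of_pos (mul_pos ha hy), div_le_iff₀ (mul_pos ha hy)]
    refine (hE y hy).trans (le_of_eq ?_)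
    rw [h5]
    field_simp
  refine ⟨a ^ r * (K * D ^ 2 + C / a), by positivity, fun y hy => ?_⟩
  set x : Fin r → ℝ := fun i => tauSum (y i) / (a * y i) - 1
  set W := ∑ i, y i ^ (θ - 1)
  have hY : 0 < ∏ i, y i := Finset.prod_pos fun i _ => hy i
  have h1 : ∏ i, tauSum (y i) = a ^ r * (∏ i, y i) * ∏ i, (1 + x i) := by
    rw [← Fin.prod_const, ← Finset.prod_mul_distrib, ← Finset.prod_mul_distrib]
    refine Finset.prod_congr rfl fun i _ => ?_
    have := (hy i).ne'
    simp only [x]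
    field_simp
    ring
  have h2 : |∏ i, (1 + x i) - (1 + ∑ i, x i)| ≤ K * D ^ 2 * W := by
    refine (hprod x fun i => (hsmall _ (hy i)).1).trans ?_
    refine (mul_le_mul_of_nonneg_left
      (Finset.sum_le_sum fun i _ => (hsmall _ (hy i)).2) hK).trans (le_of_eq ?_)
    rw [← Finset.mul_sum, mul_assoc]
  have h3 : |∑ i, x i - ∑ i, b / a * y i ^ (-(1 / 2) : ℝ)| ≤ C / a * W := by
    rw [← Finset.sum_sub_distrib, Finset.mul_sum]
    exact (Finset.abs_sum_le_sum_abs _ _).trans (Finset.sum_le_sum fun i _ => hlin _ (hy i))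
  rw [h1, ← mul_sub, abs_mul, abs_of_pos (by positivity)]
  have h4 : |∏ i, (1 + x i) - (1 + ∑ i, b / a * y i ^ (-(1 / 2) : ℝ))| ≤
      (K * D ^ 2 + C / a) * W := by
    calc _ = |(∏ i, (1 + x i) - (1 + ∑ i, x i)) +
          (∑ i, x i - ∑ i, b / a * y i ^ (-(1 / 2) : ℝ))| := by ring_nf
      _ ≤ _ := abs_add_le _ _
      _ ≤ _ := by linarith
  calc _ ≤ a ^ r * (∏ i, y i) * ((K * D ^ 2 + C / a) * W) := by gcongr
    _ = _ := by ring

/-- Writing $n_i=d_ie_i$ turns the condition $n_i\le x$ into $e_i\le x/d_i$, and the sum over the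
$e_i$ factors. -/
theorem sum_tupleConv_eq (h : (Fin r → ℕ) → ℝ) (x : ℝ) :
    ∑ n ∈ tuplesUpTo r x, tupleConv h tauTuple n =
      ∑ d ∈ tuplesUpTo r x, h d * ∏ i, tauSum (x / d i) := by
  have hR : ∀ d : Fin r → ℕ, ∏ i, tauSum (x / d i) =
      ∑ e ∈ Fintype.piFinset fun i => Finset.Icc 1 (⌊x⌋₊ / d i), tauTuple e := by
    intro d
    simp_rw [tauSum, Nat.floor_div_natCast, tauTuple]
    exact Finset.prod_univ_sum _ _
  simp_rw [hR, Finset.mul_sum, tupleConv]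
  rw [Finset.sum_sigma', Finset.sum_sigma']
  refine Finset.sum_nbij' (fun z => ⟨z.2, fun i => z.1 i / z.2 i⟩)
    (fun z => ⟨fun i => z.1 i * z.2 i, z.1⟩) ?_ ?_ ?_ ?_ ?_
  · rintro ⟨n, d⟩ hz
    simp only [Finset.mem_sigma, tuplesUpTo, Fintype.mem_piFinset, Finset.mem_Icc,
      Nat.mem_divisors] at hz ⊢
    obtain ⟨h1, h2⟩ := hz
    refine ⟨fun i => ⟨Nat.pos_of_dvd_of_pos (h2 i).1 (h1 i).1,
      (Nat.le_of_dvd (h1 i).1 (h2 i).1).trans (h1 i).2⟩, fun i =>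
      ⟨Nat.div_pos (Nat.le_of_dvd (h1 i).1 (h2 i).1) (Nat.pos_of_dvd_of_pos (h2 i).1 (h1 i).1),
        Nat.div_le_div_right (h1 i).2⟩⟩
  · rintro ⟨d, e⟩ hz
    simp only [Finset.mem_sigma, tuplesUpTo, Fintype.mem_piFinset, Finset.mem_Icc,
      Nat.mem_divisors] at hz ⊢
    obtain ⟨h1, h2⟩ := hz
    refine ⟨fun i => ⟨Nat.mul_pos (h1 i).1 (h2 i).1, ?_⟩, fun i => ⟨dvd_mul_right _ _,
      (Nat.mul_pos (h1 i).1 (h2 i).1).ne'⟩⟩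
    have := (Nat.le_div_iff_mul_le (h1 i).1).1 (h2 i).2
    rwa [mul_comm]
  · rintro ⟨n, d⟩ hz
    simp only [Finset.mem_sigma, Fintype.mem_piFinset, Nat.mem_divisors] at hz
    have : (fun i => d i * (n i / d i)) = n := funext fun i => Nat.mul_div_cancel' (hz.2 i).1
    simp [this]
  · rintro ⟨d, e⟩ hz
    simp only [Finset.mem_sigma, tuplesUpTo, Fintype.mem_piFinset, Finset.mem_Icc] at hz
    have : (fun i => d i * e i / d i) = e := funext fun i => Nat.mul_div_cancel_left _ (hz.1 i).1
    simp [this]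
  · intros
    rfl

/-- The summatory function of `h * τ_{1,2} ⊗ ⋯ ⊗ τ_{1,2}`, for `h` with convergent Dirichlet
series near the points in question. -/
theorem exists_sum_tupleConv_bound (hr : 0 < r) {h : (Fin r → ℕ) → ℝ}
    (h0 : ∀ d, (∃ i, d i = 0) → h d = 0)
    (hsum : ∀ i : Fin r, ∀ s : ℝ, 1 / 5 < s → s ≤ 1 →
      Summable fun d => |h d * tupleWeight (pointAt i s) d|)
    {θ C : ℝ} (hθ0 : 1 / 5 < θ) (hθ : θ ≤ 1 / 2) (hC : 0 ≤ C)
    (hE : ∀ y : ℝ, 0 < y →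
      |tauSum y - (zetaReal 2 * y + zetaReal (1 / 2) * y ^ (1 / 2 : ℝ))| ≤ C * y ^ θ) :
    ∃ K : ℝ, ∀ x : ℝ, 0 < x →
      |∑ n ∈ tuplesUpTo r x, tupleConv h tauTuple n -
        (zetaReal 2 ^ r * (∑' d, h d * tupleWeight (fun _ => 1) d) * x ^ r +
          zetaReal 2 ^ (r - 1) * zetaReal (1 / 2) *
            (∑ i, ∑' d, h d * tupleWeight (pointAt i (1 / 2)) d) * x ^ ((r : ℝ) - 1 / 2))| ≤
        K * x ^ ((r : ℝ) - 1 + θ) := by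
  obtain ⟨K, hK, hb⟩ := exists_prod_tauSum_bound r (by linarith) hθ hC hE
  have ha := zetaReal_two_pos
  set a := zetaReal 2
  set b := zetaReal (1 / 2)
  have hone : ∀ i : Fin r, pointAt i 1 = fun _ => 1 := fun i => by
    funext j
    simp [pointAt]
  have hs1 : Summable fun d => h d * tupleWeight (fun _ => 1) d := by
    have := hsum ⟨0, hr⟩ 1 (by norm_num) le_rfl
    rw [hone] at this
    exact this.of_abs
  have hs2 : ∀ i, Summable fun d => h d * tupleWeight (pointAt i (1 / 2)) d := fun i =>
    (hsum i (1 / 2) (by norm_num) (by norm_num)).of_abs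
  have hs3 : Summable fun d => ∑ i, |h d * tupleWeight (pointAt i θ) d| :=
    summable_sum fun i _ => hsum i θ hθ0 (by linarith)
  refine ⟨K * ∑' d, ∑ i, |h d * tupleWeight (pointAt i θ) d|, fun x hx => ?_⟩
  have hprodw : ∀ d : Fin r → ℕ, (∀ i, d i ≠ 0) → ∀ s : ℝ, ∀ i : Fin r,
      (∏ j, x / (d j : ℝ)) * (x / d i) ^ (s - 1) =
        x ^ ((r : ℝ) - 1 + s) * tupleWeight (pointAt i s) d := by
    intro d hd s i
    have hd0 : ∀ j, (0 : ℝ) < d j := fun j => by exact_mod_cast Nat.pos_of_ne_zero (hd j)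
    have h1 : tupleWeight (pointAt i s) d = (∏ j, (d j : ℝ)⁻¹) * (d i : ℝ) ^ (1 - s) := by
      have : ∀ j, (d j : ℝ) ^ (-pointAt i s j) =
          (d j : ℝ)⁻¹ * if j = i then (d i : ℝ) ^ (1 - s) else 1 := by
        intro j
        by_cases hj : j = i
        · subst hj
          rw [if_pos rfl, pointAt, if_pos rfl, ← Real.rpow_neg_one, ← Real.rpow_add (hd0 j)]
          ring_nf
        · simp [pointAt, hj, Real.rpow_neg_one]
      simp_rw [tupleWeight, this, Finset.prod_mul_distrib]
      simp
    have h2 : x ^ ((r : ℝ) - 1 + s) = x ^ r * x ^ (s - 1) := by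
      rw [← Real.rpow_natCast, ← Real.rpow_add hx]
      ring_nf
    have h3 : (d i : ℝ) ^ (1 - s) = ((d i : ℝ) ^ (s - 1))⁻¹ := by
      rw [← Real.rpow_neg (hd0 i).le, neg_sub]
    rw [h1, h2, h3, Real.div_rpow hx.le (hd0 i).le]
    simp_rw [div_eq_mul_inv, Finset.prod_mul_distrib, Fin.prod_const]
    ring
  have hprod1 : ∀ d : Fin r → ℕ, ∏ j, x / (d j : ℝ) = x ^ r * tupleWeight (fun _ => 1) d := by
    intro d
    simp_rw [tupleWeight, Real.rpow_neg_one, div_eq_mul_inv, Finset.prod_mul_distrib,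
      Fin.prod_const]
  -- Since $T(x/d_i)=0$ for $d_i>x$, the finite sum is a series over all tuples. It can be compared
  -- termwise with the complete main-term series, so no tails need separate estimates.
  have hfin : HasSum (fun d => h d * ∏ i, tauSum (x / d i))
      (∑ n ∈ tuplesUpTo r x, tupleConv h tauTuple n) := by
    rw [sum_tupleConv_eq]
    refine hasSum_sum_of_ne_finset_zero fun d hd => ?_
    by_cases hz : ∃ i, d i = 0
    · rw [h0 d hz, zero_mul]
    · push Not at hz
      simp only [tuplesUpTo, Fintype.mem_piFinset, Finset.mem_Icc, not_forall, not_and,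
        not_le] at hd
      obtain ⟨i, hi⟩ := hd
      have hlt : x < d i := Nat.lt_of_floor_lt (hi (Nat.pos_of_ne_zero (hz i)))
      have hd0 : (0 : ℝ) < d i := hx.trans hlt
      rw [Finset.prod_eq_zero (Finset.mem_univ i) (tauSum_of_lt_one ((div_lt_one hd0).2 hlt)),
        mul_zero]
  have hmain : HasSum (fun d => a ^ r * x ^ r * (h d * tupleWeight (fun _ => 1) d) +
      a ^ (r - 1) * b * x ^ ((r : ℝ) - 1 / 2) *
        ∑ i, h d * tupleWeight (pointAt i (1 / 2)) d)
      (a ^ r * (∑' d, h d * tupleWeight (fun _ => 1) d) * x ^ r + a ^ (r - 1) * b *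
        (∑ i, ∑' d, h d * tupleWeight (pointAt i (1 / 2)) d) * x ^ ((r : ℝ) - 1 / 2)) := by
    have h1 := (hs1.hasSum.mul_left (a ^ r * x ^ r)).add
      ((hasSum_sum fun i (_ : i ∈ Finset.univ) => (hs2 i).hasSum).mul_left
        (a ^ (r - 1) * b * x ^ ((r : ℝ) - 1 / 2)))
    have e : a ^ r * (∑' d, h d * tupleWeight (fun _ => 1) d) * x ^ r + a ^ (r - 1) * b *
        (∑ i, ∑' d, h d * tupleWeight (pointAt i (1 / 2)) d) * x ^ ((r : ℝ) - 1 / 2) =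
        a ^ r * x ^ r * (∑' d, h d * tupleWeight (fun _ => 1) d) +
          a ^ (r - 1) * b * x ^ ((r : ℝ) - 1 / 2) *
            ∑ i, ∑' d, h d * tupleWeight (pointAt i (1 / 2)) d := by ring
    rw [e]
    exact h1
  have hdiff := hfin.sub hmain
  rw [← hdiff.tsum_eq, ← Real.norm_eq_abs, mul_right_comm K]
  refine tsum_of_norm_bounded (hs3.hasSum.mul_left (K * x ^ ((r : ℝ) - 1 + θ))) fun d => ?_
  by_cases hz : ∃ i, d i = 0
  · simp [h0 d hz]
  · push Not at hz
    have hy : ∀ i, 0 < x / (d i : ℝ) := fun i =>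
      div_pos hx (by exact_mod_cast Nat.pos_of_ne_zero (hz i))
    have h1 := hb _ hy
    have har : a ^ r = a ^ (r - 1) * a := by rw [← pow_succ, Nat.sub_add_cancel hr]
    have h2 : a ^ r * (∏ i, x / (d i : ℝ)) *
        (1 + ∑ i, b / a * (x / (d i : ℝ)) ^ (-(1 / 2) : ℝ)) =
        a ^ r * x ^ r * tupleWeight (fun _ => 1) d +
          a ^ (r - 1) * b * x ^ ((r : ℝ) - 1 / 2) * ∑ i, tupleWeight (pointAt i (1 / 2)) d := by
      rw [mul_add, mul_one, hprod1, Finset.mul_sum, Finset.mul_sum]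
      congr 1
      · ring
      · refine Finset.sum_congr rfl fun i _ => ?_
        have h3 := hprodw d hz (1 / 2) i
        rw [hprod1, show (1 / 2 : ℝ) - 1 = -(1 / 2) by norm_num,
          show (r : ℝ) - 1 + 1 / 2 = r - 1 / 2 by ring] at h3
        calc _ = a ^ r * (b / a) * (x ^ r * tupleWeight (fun _ => 1) d *
              (x / (d i : ℝ)) ^ (-(1 / 2) : ℝ)) := by ring
          _ = _ := by
            rw [h3, har]
            field_simp
    have h4 : (∏ i, x / (d i : ℝ)) * ∑ i, (x / (d i : ℝ)) ^ (θ - 1) =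
        x ^ ((r : ℝ) - 1 + θ) * ∑ i, tupleWeight (pointAt i θ) d := by
      rw [Finset.mul_sum, Finset.mul_sum]
      exact Finset.sum_congr rfl fun i _ => hprodw d hz θ i
    rw [h2, h4] at h1
    have hw : ∀ i, |h d * tupleWeight (pointAt i θ) d| = |h d| * tupleWeight (pointAt i θ) d :=
      fun i => by
        have hw0 : 0 ≤ tupleWeight (pointAt i θ) d :=
          Finset.prod_nonneg fun j _ => Real.rpow_nonneg (Nat.cast_nonneg _) _
        rw [abs_mul, abs_of_nonneg hw0]
    simp_rw [hw, ← Finset.mul_sum]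
    calc _ = |h d * (∏ i, tauSum (x / (d i : ℝ)) - (a ^ r * x ^ r * tupleWeight (fun _ => 1) d +
          a ^ (r - 1) * b * x ^ ((r : ℝ) - 1 / 2) *
            ∑ i, tupleWeight (pointAt i (1 / 2)) d))| := by
          rw [Real.norm_eq_abs]
          ring_nf
      _ ≤ |h d| * (K * (x ^ ((r : ℝ) - 1 + θ) * ∑ i, tupleWeight (pointAt i θ) d)) := by
          rw [abs_mul]
          exact mul_le_mul_of_nonneg_left h1 (abs_nonneg _)
      _ = _ := by ring

/-! ### Euler products for the two constants. -/

theorem hasProd_zetaReal_two :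
    HasProd (fun p : Nat.Primes => (1 - (((p : ℕ) : ℝ) ^ 2)⁻¹)⁻¹) (zetaReal 2) := by
  let f : ℕ →*₀ ℝ :=
    { toFun := fun n => ((n : ℝ) ^ 2)⁻¹
      map_zero' := by simp
      map_one' := by simp
      map_mul' := fun m n => by
        push_cast
        rw [mul_pow, mul_inv] }
  have hf : ∀ n, f n = ((n : ℝ) ^ 2)⁻¹ := fun _ => rfl
  have hs : Summable (‖f ·‖) := hasSum_zetaReal_two.summable.norm
  have h := EulerProduct.eulerProduct_completely_multiplicative_hasProd hs
  rw [← hasSum_zetaReal_two.tsum_eq]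
  exact h

/-- The coefficients of the full local series, including the constant term `1`. -/
def extCoeff (c : (Fin r → ℕ) → ℕ) (ν : Fin r → ℕ) : ℝ := if ν = 0 then 1 else (c ν : ℝ)

/-- The properties of the local coefficients `c` used in the proof: linear growth,
`c(0, …, k, …, 0) = τ(k)` and symmetry. -/
structure IsTauCoeff (c : (Fin r → ℕ) → ℕ) : Prop where
  le_sum : ∀ ν, c ν ≤ ∑ i, ν i
  single : ∀ i k, c (Pi.single i k) = k.divisors.card
  symm : ∀ (σ : Equiv.Perm (Fin r)) ν, c (ν ∘ σ) = c ν

theorem isTauCoeff_sumCoeff (r : ℕ) : IsTauCoeff (sumCoeff r) where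
  le_sum ν := Nat.card_divisors_le_self _
  single i k := by simp [sumCoeff]
  symm σ ν := by
    simp only [sumCoeff, Function.comp_apply]
    rw [Equiv.sum_comp σ ν]

theorem isTauCoeff_maxCoeff (r : ℕ) : IsTauCoeff (maxCoeff r) where
  le_sum ν := (Nat.card_divisors_le_self _).trans
    (Finset.sup_le fun i _ => Finset.single_le_sum (fun _ _ => Nat.zero_le _) (Finset.mem_univ i))
  single i k := by
    have : Finset.univ.sup (Pi.single i k : Fin r → ℕ) = k := by
      apply le_antisymm
      · refine Finset.sup_le fun j _ => ?_
        by_cases h : j = i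
        · subst h
          simp
        · simp [h]
      · simpa using Finset.le_sup (f := (Pi.single i k : Fin r → ℕ)) (Finset.mem_univ i)
    rw [maxCoeff, this]
  symm σ ν := by
    have : Finset.univ.sup (ν ∘ σ) = Finset.univ.sup ν := by
      rw [← Finset.sup_image, Finset.image_univ_equiv]
    rw [maxCoeff, maxCoeff, this]

namespace IsTauCoeff

variable {c : (Fin r → ℕ) → ℕ}

theorem abs_extCoeff_le (hc : IsTauCoeff c) (ν : Fin r → ℕ) :
    |extCoeff c ν| ≤ ∑ i, (ν i : ℝ) + 1 := by
  unfold extCoeff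
  split_ifs with h
  · simp [h]
  · rw [abs_of_nonneg (Nat.cast_nonneg _)]
    have : (c ν : ℝ) ≤ ((∑ i, ν i : ℕ) : ℝ) := by exact_mod_cast hc.le_sum ν
    push_cast at this
    linarith

theorem abs_localInv_le (hc : IsTauCoeff c) (ν : Fin r → ℕ) :
    |localInv (extCoeff c) ν| ≤ 4 ^ r * (∑ i, (ν i : ℝ) + 1) :=
  _root_.abs_localInv_le hc.abs_extCoeff_le ν

theorem localInv_single (hc : IsTauCoeff c) (i : Fin r) (k : ℕ) (hk : 1 ≤ k) (hk4 : k ≤ 4) :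
    localInv (extCoeff c) (Pi.single i k) = 0 := by
  refine localInv_single_eq_zero (by simp [extCoeff]) (fun i k hk => ?_) i hk hk4
  rw [extCoeff, if_neg (by simpa using hk), hc.single]

end IsTauCoeff

theorem localTerm_eq (c : (Fin r → ℕ) → ℕ) (s : Fin r → ℝ) {p : ℕ} (hp : p.Prime)
    (ν : Fin r → ℕ) : localTerm c s p ν =
      if ν = 0 then 0 else extCoeff c ν * ∏ j, ((p : ℝ) ^ (-s j)) ^ ν j := by
  have hp0 : (0 : ℝ) < p := by exact_mod_cast hp.pos
  by_cases h : ν = 0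
  · simp [localTerm, h]
  · have : 1 ≤ ∑ i, ν i := by
      by_contra! hlt
      refine h (funext fun i => ?_)
      have := Finset.single_le_sum (f := ν) (fun _ _ => Nat.zero_le _) (Finset.mem_univ i)
      simp only [Pi.zero_apply]
      omega
    rw [localTerm, if_pos this, if_neg h, extCoeff, if_neg h, ← rpow_neg_sum_eq_prod hp0,
      Real.rpow_neg hp0.le, div_eq_mul_inv]

theorem rpow_neg_lt_one {p : ℕ} (hp : p.Prime) {s : ℝ} (hs : 0 < s) : (p : ℝ) ^ (-s) < 1 :=
  Real.rpow_lt_one_of_one_lt_of_neg (by exact_mod_cast hp.one_lt) (by linarith)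

namespace IsTauCoeff

variable {c : (Fin r → ℕ) → ℕ}

theorem summable_extCoeff (hc : IsTauCoeff c) {p : ℕ} (hp : p.Prime) {s : Fin r → ℝ}
    (hs : ∀ j, 0 < s j) :
    Summable fun ν : Fin r → ℕ => extCoeff c ν * ∏ j, ((p : ℝ) ^ (-s j)) ^ ν j :=
  summable_mul_geometric (C := 1) (fun ν => by simpa using hc.abs_extCoeff_le ν)
    (fun j => by positivity) fun j => rpow_neg_lt_one hp (hs j)

theorem summable_localTerm (hc : IsTauCoeff c) {p : ℕ} (hp : p.Prime) {s : Fin r → ℝ}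
    (hs : ∀ j, 0 < s j) : Summable (localTerm c s p) := by
  refine (hc.summable_extCoeff hp hs).abs.of_norm_bounded fun ν => ?_
  rw [localTerm_eq c s hp]
  split_ifs
  · simp only [norm_zero]
    exact abs_nonneg _
  · rfl

theorem localSeries_eq (hc : IsTauCoeff c) {p : ℕ} (hp : p.Prime) {s : Fin r → ℝ}
    (hs : ∀ j, 0 < s j) :
    localSeries c s p = ∑' ν : Fin r → ℕ, extCoeff c ν * ∏ j, ((p : ℝ) ^ (-s j)) ^ ν j := by
  rw [(hc.summable_extCoeff hp hs).tsum_eq_add_tsum_ite 0, localSeries]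
  congr 1
  · simp [extCoeff]
  · exact tsum_congr fun ν => localTerm_eq c s hp ν

theorem tsum_localInv (hc : IsTauCoeff c) {p : ℕ} (hp : p.Prime) {s : Fin r → ℝ}
    (hs : ∀ j, 0 < s j) :
    ∑' ν : Fin r → ℕ, localInv (extCoeff c) ν * (p : ℝ) ^ (-∑ j, (ν j : ℝ) * s j) =
      (∏ j, (1 - (p : ℝ) ^ (-s j)) * (1 - ((p : ℝ) ^ (-s j)) ^ 2)) * localSeries c s p := by
  have hp0 : (0 : ℝ) < p := by exact_mod_cast hp.pos
  rw [hc.localSeries_eq hp hs, ← (hasSum_localInv_mul_geometric (hc.summable_extCoeff hp hs)).tsum_eq]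
  exact tsum_congr fun ν => by rw [rpow_neg_sum_eq_prod hp0]

/-- Transposing the coordinates `i` and `j` permutes the terms of the series and, by symmetry of
`c`, preserves the coefficients. -/
theorem localSeries_pointAt (hc : IsTauCoeff c) (i j : Fin r) (θ : ℝ) (p : ℕ) :
    localSeries c (pointAt i θ) p = localSeries c (pointAt j θ) p := by
  let σ := Equiv.swap i j
  let e : (Fin r → ℕ) ≃ (Fin r → ℕ) := σ.arrowCongr (Equiv.refl ℕ)
  have he : ∀ ν, e ν = ν ∘ σ := fun ν => by
    funext k
    simp [e, σ]
  rw [localSeries, localSeries, ← e.tsum_eq (localTerm c (pointAt j θ) p)]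
  congr 1
  refine tsum_congr fun ν => ?_
  have h1 : ∑ k, (ν ∘ σ) k = ∑ k, ν k := Equiv.sum_comp σ ν
  have h2 : ∑ k, (((ν ∘ σ) k : ℕ) : ℝ) * pointAt j θ k = ∑ k, (ν k : ℝ) * pointAt i θ k := by
    rw [← Equiv.sum_comp σ fun k => (ν k : ℝ) * pointAt i θ k]
    refine Finset.sum_congr rfl fun k _ => ?_
    have : pointAt j θ k = pointAt i θ (σ k) := by
      have : σ k = i ↔ k = j := by
        rw [← Equiv.eq_symm_apply]
        simp [σ]
      simp [pointAt, this]
    rw [this]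
    rfl
  rw [he, localTerm, localTerm, h1, h2, hc.symm]

/-- The value at `pointAt i θ` of the multiple Dirichlet series with local coefficients
`localInv (extCoeff c)`. -/
theorem hasProd_localSeries (hc : IsTauCoeff c) (i : Fin r) {θ : ℝ} (hθ : 1 / 5 < θ)
    (hθ1 : θ ≤ 1) :
    HasProd (fun p : Nat.Primes => (1 - 1 / ((p : ℕ) : ℝ)) ^ (r - 1) *
        ((1 - ((p : ℕ) : ℝ) ^ (-θ)) * (1 - (((p : ℕ) : ℝ) ^ (-θ)) ^ 2)) *
        localSeries c (pointAt i θ) p)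
      (zetaReal 2 ^ (r - 1) *
        ∑' d, ofLocal (localInv (extCoeff c)) d * tupleWeight (pointAt i θ) d) := by
  -- The Euler product of $\zeta(2)^{r-1}$ cancels the factors $1-p^{-2}$ coming from the $r-1$
  -- coordinates equal to 1.
  have h := (hasProd_zetaReal_two.pow (r - 1)).mul
    (hasProd_ofLocal_weight (localInv_zero (by simp [extCoeff])) hc.abs_localInv_le
      hc.localInv_single i hθ hθ1)
  convert h using 2 with p
  have hs : ∀ j, 0 < pointAt i θ j := fun j => by unfold pointAt; split_ifs <;> linarith
  rw [hc.tsum_localInv p.2 hs]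
  have hprod : ∏ j, (1 - ((p : ℕ) : ℝ) ^ (-pointAt i θ j)) *
      (1 - (((p : ℕ) : ℝ) ^ (-pointAt i θ j)) ^ 2) =
      ((1 - ((p : ℕ) : ℝ) ^ (-θ)) * (1 - (((p : ℕ) : ℝ) ^ (-θ)) ^ 2)) *
        ((1 - 1 / ((p : ℕ) : ℝ)) * (1 - (((p : ℕ) : ℝ) ^ 2)⁻¹)) ^ (r - 1) := by
    rw [← Finset.mul_prod_erase _ _ (Finset.mem_univ i)]
    congr 1
    · simp [pointAt]
    · rw [Finset.prod_congr rfl (g := fun _ => (1 - 1 / ((p : ℕ) : ℝ)) *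
        (1 - (((p : ℕ) : ℝ) ^ 2)⁻¹)), Finset.prod_const, Finset.card_erase_of_mem
        (Finset.mem_univ i), Finset.card_univ, Fintype.card_fin]
      intro j hj
      simp [pointAt, Finset.ne_of_mem_erase hj, Real.rpow_neg_one]
  have hne : (1 - (((p : ℕ) : ℝ) ^ 2)⁻¹) ≠ 0 := by
    have : (1 : ℝ) < ((p : ℕ) : ℝ) ^ 2 := one_lt_pow₀ (by exact_mod_cast p.2.one_lt) two_ne_zero
    have := inv_lt_one_of_one_lt₀ this
    linarith
  have hcancel : ((1 - (((p : ℕ) : ℝ) ^ 2)⁻¹)⁻¹) ^ (r - 1) *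
      (1 - (((p : ℕ) : ℝ) ^ 2)⁻¹) ^ (r - 1) = 1 := by
    rw [← mul_pow, inv_mul_cancel₀ hne, one_pow]
  rw [hprod, mul_pow]
  linear_combination (-((1 - 1 / ((p : ℕ) : ℝ)) ^ (r - 1) *
    ((1 - ((p : ℕ) : ℝ) ^ (-θ)) * (1 - (((p : ℕ) : ℝ) ^ (-θ)) ^ 2)) *
    localSeries c (pointAt i θ) p)) * hcancel

/-- At $\theta=1$ the distinguished coordinate also produces $1-p^{-2}$, which the $r$-th factor
$\zeta(2)$ cancels. -/
theorem hasProd_leadFactor (hc : IsTauCoeff c) (hr : 0 < r) :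
    HasProd (fun p : Nat.Primes => leadFactor c p) (zetaReal 2 ^ r *
      ∑' d, ofLocal (localInv (extCoeff c)) d * tupleWeight (fun _ => 1) d) := by
  have hone : pointAt (⟨0, hr⟩ : Fin r) 1 = fun _ => 1 := by
    funext j
    simp [pointAt]
  have h := hasProd_zetaReal_two.mul (hc.hasProd_localSeries ⟨0, hr⟩ (θ := 1) (by norm_num) le_rfl)
  rw [hone, ← mul_assoc, ← pow_succ', Nat.sub_add_cancel hr] at h
  convert h using 2 with p
  have hne : (1 - (((p : ℕ) : ℝ) ^ 2)⁻¹) ≠ 0 := by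
    have : (1 : ℝ) < ((p : ℕ) : ℝ) ^ 2 := one_lt_pow₀ (by exact_mod_cast p.2.one_lt) two_ne_zero
    have := inv_lt_one_of_one_lt₀ this
    linarith
  have hpow : (1 - 1 / ((p : ℕ) : ℝ)) ^ r =
      (1 - 1 / ((p : ℕ) : ℝ)) ^ (r - 1) * (1 - 1 / ((p : ℕ) : ℝ)) := by
    rw [← pow_succ, Nat.sub_add_cancel hr]
  rw [leadFactor, hpow, Real.rpow_neg_one, inv_pow, one_div]
  change _ * _ * localSeries c (fun _ => 1) p = _
  linear_combination (-((1 - ((p : ℕ) : ℝ)⁻¹) ^ (r - 1) * (1 - ((p : ℕ) : ℝ)⁻¹) *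
    localSeries c (fun _ => 1) p)) * inv_mul_cancel₀ hne

theorem halfPoint_eq (hr : 0 < r) : halfPoint r = pointAt ⟨0, hr⟩ (1 / 2) := by
  funext j
  simp [halfPoint, pointAt, Fin.ext_iff]

/-- At $\theta=1/2$ the factor $1-(p^{-\theta})^2$ equals $1-1/p$, which supplies the $r$-th power,
so only $\zeta(2)^{r-1}$ is needed. By symmetry the product is the same for every `i`. -/
theorem hasProd_secondFactor (hc : IsTauCoeff c) (i : Fin r) :
    HasProd (fun p : Nat.Primes => secondFactor c p) (zetaReal 2 ^ (r - 1) *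
      ∑' d, ofLocal (localInv (extCoeff c)) d * tupleWeight (pointAt i (1 / 2)) d) := by
  have hr : 0 < r := i.pos
  convert hc.hasProd_localSeries i (θ := 1 / 2) (by norm_num) (by norm_num) using 2 with p
  have hp0 : (0 : ℝ) < ((p : ℕ) : ℝ) := by exact_mod_cast p.2.pos
  rw [secondFactor, halfPoint_eq hr, hc.localSeries_pointAt ⟨0, hr⟩ i]
  have hpow : (1 - 1 / ((p : ℕ) : ℝ)) ^ r =
      (1 - 1 / ((p : ℕ) : ℝ)) ^ (r - 1) * (1 - 1 / ((p : ℕ) : ℝ)) := by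
    rw [← pow_succ, Nat.sub_add_cancel hr]
  have h1 : (((p : ℕ) : ℝ) ^ (-(1 / 2) : ℝ)) ^ 2 = 1 / ((p : ℕ) : ℝ) := by
    rw [← Real.rpow_natCast, ← Real.rpow_mul hp0.le]
    norm_num [Real.rpow_neg_one]
  have h2 : ((p : ℕ) : ℝ) ^ (-(1 / 2) : ℝ) = 1 / ((p : ℕ) : ℝ) ^ (1 / 2 : ℝ) := by
    rw [Real.rpow_neg hp0.le, one_div (_ ^ _)]
  rw [h1, h2, hpow]
  ring

theorem constantsConverge (hc : IsTauCoeff c) (hr : 0 < r) : ConstantsConverge c := by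
  refine ⟨fun p => hc.summable_localTerm p.2 fun j => one_pos, fun p => hc.summable_localTerm p.2
    fun j => ?_, (hc.hasProd_leadFactor hr).multipliable,
    (hc.hasProd_secondFactor ⟨0, hr⟩).multipliable⟩
  unfold halfPoint
  split_ifs <;> norm_num

theorem isBigO_sum (hc : IsTauCoeff c) (hr : 0 < r) {ε : ℝ} (hε : 0 < ε) :
    (fun x : ℝ => (∑ n ∈ tuplesUpTo r x, ofLocal (extCoeff c) n) -
      (leadConst c * x ^ r + secondConst c * x ^ ((r : ℝ) - 1 / 2))) =O[atTop]
      fun x : ℝ => x ^ ((r : ℝ) - 1 + max thetaTwo (1 / 5) + ε) := by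
  obtain ⟨θ, C, hθ0, hθ, hθε, hC, hE⟩ := exists_tauSum_error_bound hε
  have hB0 := localInv_zero (A := extCoeff c) (by simp [extCoeff])
  obtain ⟨K, hK⟩ := exists_sum_tupleConv_bound hr (h := ofLocal (localInv (extCoeff c)))
    (isTupleMult_ofLocal hB0).map_zero (fun i s hs hs1 =>
      summable_ofLocal_weight hB0 hc.abs_localInv_le hc.localInv_single i hs hs1) hθ0 hθ hC hE
  have hlead : leadConst c = zetaReal 2 ^ r *
      ∑' d, ofLocal (localInv (extCoeff c)) d * tupleWeight (fun _ => 1) d :=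
    (hc.hasProd_leadFactor hr).tprod_eq
  have hsecond : secondConst c = zetaReal 2 ^ (r - 1) * zetaReal (1 / 2) *
      ∑ i, ∑' d, ofLocal (localInv (extCoeff c)) d * tupleWeight (pointAt i (1 / 2)) d := by
    rw [mul_right_comm, Finset.mul_sum]
    -- All $r$ coordinate contributions become one and the same Euler product; counting them gives
    -- the factor $r$ in `secondConst`.
    simp_rw [← fun i => (hc.hasProd_secondFactor i).tprod_eq]
    rw [Finset.sum_const, Finset.card_univ, Fintype.card_fin, nsmul_eq_mul, secondConst]
    ring
  refine IsBigO.of_bound (max K 0) ?_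
  filter_upwards [eventually_ge_atTop 1] with x hx
  have hx0 : 0 < x := by linarith
  rw [hlead, hsecond, ofLocal_eq_tupleConv (by simp [extCoeff]), Real.norm_eq_abs,
    Real.norm_of_nonneg (by positivity)]
  refine (hK x hx0).trans ?_
  refine mul_le_mul (le_max_left _ _) ?_ (by positivity) (le_max_right _ _)
  exact Real.rpow_le_rpow_of_exponent_le hx (by linarith)

end IsTauCoeff

/-! ### Return to the exponential divisor function. -/

/-- Common to the product and the least common multiple, whose exponents at $p$ are the sum and the
maximum of those of the $n_i$. The last hypothesis ensures that at primes dividing `m` the exponent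
tuple is nonzero, so `extCoeff` takes the value of `c` there and not the constant term 1. -/
theorem ofLocal_extCoeff_eq_tauExp {c : (Fin r → ℕ) → ℕ} {n : Fin r → ℕ} (hn : ∀ i, n i ≠ 0)
    {m : ℕ} (hm : m ≠ 0) (hdvd : ∀ i, n i ∣ m)
    (hc : ∀ p, c (fun i => (n i).factorization p) = (m.factorization p).divisors.card)
    (h0 : ∀ p, m.factorization p ≠ 0 → ∃ i, (n i).factorization p ≠ 0) :
    ofLocal (extCoeff c) n = tauExp m := by
  rw [ofLocal_eq_prod (by simp [extCoeff]) hn (S := m.primeFactors)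
    fun i => Nat.primeFactors_mono (hdvd i) hm, tauExp, Finsupp.prod, Nat.support_factorization,
    Nat.cast_prod]
  refine Finset.prod_congr rfl fun p hp => ?_
  rw [← Nat.support_factorization, Finsupp.mem_support_iff] at hp
  obtain ⟨i, hi⟩ := h0 p hp
  rw [extCoeff, if_neg fun h => hi (congrFun h i), hc]

theorem tauExp_prod_eq {n : Fin r → ℕ} (hn : ∀ i, n i ≠ 0) :
    ofLocal (extCoeff (sumCoeff r)) n = tauExp (∏ i, n i) := by
  have hf : ∀ p, (∏ i, n i).factorization p = ∑ i, (n i).factorization p := fun p => by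
    rw [Nat.factorization_prod fun i _ => hn i, Finsupp.finsetSum_apply]
  refine ofLocal_extCoeff_eq_tauExp hn (Finset.prod_ne_zero_iff.2 fun i _ => hn i)
    (fun i => Finset.dvd_prod_of_mem n (Finset.mem_univ i)) (fun p => by rw [sumCoeff, hf])
    fun p hp => ?_
  rw [hf] at hp
  obtain ⟨i, -, hi⟩ := Finset.exists_ne_zero_of_sum_ne_zero hp
  exact ⟨i, hi⟩

theorem tauExp_lcm_eq {n : Fin r → ℕ} (hn : ∀ i, n i ≠ 0) :
    ofLocal (extCoeff (maxCoeff r)) n = tauExp (Finset.univ.lcm n) := by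
  have hf : ∀ p, (Finset.univ.lcm n).factorization p =
      Finset.univ.sup fun i => (n i).factorization p :=
    Finset.factorization_lcm fun i _ => hn i
  refine ofLocal_extCoeff_eq_tauExp hn (fun h => ?_)
    (fun i => Finset.dvd_lcm (Finset.mem_univ i)) (fun p => by rw [maxCoeff, hf]) fun p hp => ?_
  · obtain ⟨i, -, hi⟩ := Finset.lcm_eq_zero_iff.1 h
    exact hn i hi
  · rw [hf] at hp
    by_contra! h
    exact hp (by simp [h])

theorem ne_zero_of_mem_tuplesUpTo {x : ℝ} {n : Fin r → ℕ} (hn : n ∈ tuplesUpTo r x) (i : Fin r) :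
    n i ≠ 0 :=
  Nat.one_le_iff_ne_zero.1 (Finset.mem_Icc.1 (Fintype.mem_piFinset.1 hn i)).1

end

theorem mainTheorem2 (r : ℕ) (hr : 2 ≤ r) :
    IsLeast {θ : ℝ | IsErrorExponent θ} thetaTwo ∧
    ConstantsConverge (sumCoeff r) ∧
    ConstantsConverge (maxCoeff r) ∧
    (∀ ε : ℝ, 0 < ε →
      (fun x : ℝ => (∑ n ∈ tuplesUpTo r x, (tauExp (∏ i, n i) : ℝ))
          - (leadConst (sumCoeff r) * x ^ r
            + secondConst (sumCoeff r) * x ^ ((r : ℝ) - 1 / 2)))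
        =O[atTop] fun x : ℝ => x ^ ((r : ℝ) - 1 + max thetaTwo (1 / 5) + ε)) ∧
    (∀ ε : ℝ, 0 < ε →
      (fun x : ℝ => (∑ n ∈ tuplesUpTo r x, (tauExp (Finset.univ.lcm n) : ℝ))
          - (leadConst (maxCoeff r) * x ^ r
            + secondConst (maxCoeff r) * x ^ ((r : ℝ) - 1 / 2)))
        =O[atTop] fun x : ℝ => x ^ ((r : ℝ) - 1 + max thetaTwo (1 / 5) + ε)) := by
  have hr0 : 0 < r := by omega
  have hs := isTauCoeff_sumCoeff r
  have hm := isTauCoeff_maxCoeff r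
  refine ⟨isLeast_thetaTwo, hs.constantsConverge hr0, hm.constantsConverge hr0, fun ε hε => ?_,
    fun ε hε => ?_⟩
  · refine (hs.isBigO_sum hr0 hε).congr_left fun x => ?_
    rw [Finset.sum_congr rfl fun n hn => tauExp_prod_eq (ne_zero_of_mem_tuplesUpTo hn)]
  · refine (hm.isBigO_sum hr0 hε).congr_left fun x => ?_
    rw [Finset.sum_congr rfl fun n hn => tauExp_lcm_eq (ne_zero_of_mem_tuplesUpTo hn)]
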